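/- Let $C_1,C_2$ be real symmetric $3\times 3$ matrices of ordered signature $(+,+,-)$, meaning that for $i=1,2$ one has $(x,y,0)\,C_i\,(x,y,0)^T>0$ whenever $(x,y)\ne(0,0)$, and $\det C_i<0$. Suppose that $C_1^{-1}C_2$ has three distinct positive eigenvalues $\lambda_1>\lambda_2>\lambda_3>0$, and that $\mathbf u^TC_1\mathbf u<0$ whenever $\mathbf u\neq 0$ and $\mathbf u^TC_2\mathbf u=0$ (the second ellipse is inside the first). For $\nu=(\nu_1,\nu_2)\in\mathbb R^2$ put $$\mathcal C_\nu=\{(x,y)\in\mathbb R^2:\ \mathbf u^T(\nu_1C_1+\nu_2C_2)\mathbf u=0,\ \mathbf u=(x,y,1)^T\},\qquad \mathcal C_1=\mathcal C_{(1,0)}.$$ Call $\nu$ *valid* if $\nu_2>0$ and $\nu_1+\lambda_3\nu_2>0$; then $\mathcal C_\nu$ is an ellipse in the interior of $\mathcal C_1$. On the boundary of this cone lies the limiting parameter $\nu^\infty=(-\lambda_3,1)$, for which $\mathcal C_\infty=\mathcal C_{\nu^\infty}$ is a single point in the interior of $\mathcal C_1$. A segment $\overrightarrow{zw}$, $z\ne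 w$, is *tangent* to $\mathcal C_\nu$ with positive (resp. negative) orientation if it touches $\mathcal C_\nu$ at a point of the segment and $\mathcal C_\nu$ lies on the left (resp. right) when moving from $z$ to $w$. A segment is called tangent to the single point $\mathcal C_\infty$ if it passes through it, and both orientations are then allowed. For $\nu$ valid or $\nu=\nu^\infty$, the *Poncelet map* $P_\nu:\mathcal C_1\to\mathcal C_1$ is the homeomorphism such that, for each $z\in\mathcal C_1$, $P_\nu(z)$ is the unique point $w\in\mathcal C_1$ for which $\overrightarrow{zw}$ is tangent to $\mathcal C_\nu$ with positive orientation. **Theorem (Poncelet).** Let $N\ge 0$ and let $z_0,z_1,\dots,z_N\in\mathcal C_1$ with $z_{k-1}\neq z_k$ for $k=1,\dots,N$. Then there are parameters $\nu^1,\dots,\nu^N$ and signs $\sigma_1,\dots,\sigma_N\in\{1,-1\}$, where $\nu^k$ is valid if the segment $z_{k-1}z_k$ does not contain the point $\mathcal C_\infty$, and $\nu^k=\nu^\infty$ if it does, such that each Poncelet map $P_{\nu^k}$ exists and: 1. for each $k=1,\dots,N$ the segment $\overrightarrow{z_{k-1}z_k}$ is tangent to $\mathcal C_{\nu^k}$,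 with positive orientation if $\sigma_k=1$ and negative orientation if $\sigma_k=-1$; moreover $\mathcal C_{\nu^k}$ is the only member $\mathcal C_\mu$ of the pencil, with $\mu$ valid or $\mu=\nu^\infty$, to which this segment is tangent; 2. $(P_{\nu^k})^{\sigma_k}(z_{k-1})=z_k$ for each $k=1,\dots,N$; 3. if $z_0=z_N$, then $(P_{\nu^N})^{\sigma_N}\circ(P_{\nu^{N-1}})^{\sigma_{N-1}}\circ\cdots\circ(P_{\nu^1})^{\sigma_1}=\mathrm{id}$ on $\mathcal C_1$. -/

import Mathlib

namespace PonceletPencil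

/-- The vector `(x, y, 1)` of homogeneous coordinates of a point of the plane. -/
def homog (p : ℝ × ℝ) : Fin 3 → ℝ := ![p.1, p.2, 1]

/-- The quadratic form `uᵀ C u`. -/
def quad (C : Matrix (Fin 3) (Fin 3) ℝ) (u : Fin 3 → ℝ) : ℝ := u ⬝ᵥ C.mulVec u

/-- The plane conic `{(x, y) : uᵀ C u = 0, u = (x, y, 1)}`. -/
def conic (C : Matrix (Fin 3) (Fin 3) ℝ) : Set (ℝ × ℝ) := {p | quad C (homog p) = 0}

/-- The member `ν₁ C₁ + ν₂ C₂` of the pencil generated by `C₁` and `C₂`. -/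
def pencil (C₁ C₂ : Matrix (Fin 3) (Fin 3) ℝ) (ν : ℝ × ℝ) : Matrix (Fin 3) (Fin 3) ℝ :=
  ν.1 • C₁ + ν.2 • C₂

/-- A real symmetric matrix of ordered signature `(+,+,-)`: positive definite upper-left
`2 × 2` block and negative determinant. -/
structure OrderedSignature (C : Matrix (Fin 3) (Fin 3) ℝ) : Prop where
  symm : C.IsSymm
  pos : ∀ x y : ℝ, (x, y) ≠ (0, 0) → 0 < quad C ![x, y, 0]
  det_neg : C.det < 0

/-- The standing assumptions on the generators of the pencil: both have ordered signature
`(+,+,-)`, the matrix `C₁⁻¹ C₂` has three distinct positive eigenvalues (labelled in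
decreasing order), and the second conic is inside the first. -/
structure StandingAssumptions (C₁ C₂ : Matrix (Fin 3) (Fin 3) ℝ) (lam₁ lam₂ lam₃ : ℝ) :
    Prop where
  sig₁ : OrderedSignature C₁
  sig₂ : OrderedSignature C₂
  eig₁ : Module.End.HasEigenvalue (Matrix.toLin' (C₁⁻¹ * C₂)) lam₁
  eig₂ : Module.End.HasEigenvalue (Matrix.toLin' (C₁⁻¹ * C₂)) lam₂
  eig₃ : Module.End.HasEigenvalue (Matrix.toLin' (C₁⁻¹ * C₂)) lam₃
  lt₁₂ : lam₂ < lam₁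
  lt₂₃ : lam₃ < lam₂
  pos₃ : 0 < lam₃
  inside : ∀ u : Fin 3 → ℝ, u ≠ 0 → quad C₂ u = 0 → quad C₁ u < 0

/-- Valid parameters of the pencil; `lam₃` is the smallest eigenvalue of `C₁⁻¹ C₂`. -/
def IsValid (lam₃ : ℝ) (ν : ℝ × ℝ) : Prop := 0 < ν.2 ∧ 0 < ν.1 + lam₃ * ν.2

/-- The parameter on the boundary of the cone of valid parameters whose conic is the limiting
point of the pencil. -/
def limitParam (lam₃ : ℝ) : ℝ × ℝ := (-lam₃, 1)

/-- The cross product of two plane vectors: `cross v w > 0` means that `w` points to the left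
of `v`. -/
def cross (v w : ℝ × ℝ) : ℝ := v.1 * w.2 - v.2 * w.1

/-- The nondegenerate segment `zw` touches the conic `C` at some point `p`: the point `p` lies
on both, and the derivative of the equation of the conic at `p`, which is `h ↦ 2 uᵀ C (h, 0)`
with `u` the homogeneous coordinates of `p`, vanishes in the direction `w - z`. When the conic
is a single point (the limiting member of the pencil), this says that the segment passes
through that point. -/
def SegTangent (C : Matrix (Fin 3) (Fin 3) ℝ) (z w : ℝ × ℝ) : Prop :=
  z ≠ w ∧ ∃ p ∈ conic C, p ∈ segment ℝ z w ∧
    homog p ⬝ᵥ C.mulVec ![(w - z).1, (w - z).2, 0] = 0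

/-- The segment from `z` to `w` is tangent to the conic with orientation `s`: moving from `z`
to `w`, the conic (apart from the point of contact) is on the left if `s = 1`, and on the right
if `s = -1`. -/
def OrientedTangent (s : ℤˣ) (C : Matrix (Fin 3) (Fin 3) ℝ) (z w : ℝ × ℝ) : Prop :=
  SegTangent C z w ∧
    ∀ q ∈ conic C, q ∉ segment ℝ z w → 0 < (((s : ℤˣ) : ℤ) : ℝ) * cross (w - z) (q - z)

/-- `P` is the Poncelet map of the outer conic `C₁` and the inner conic `C`: the image of `z`
is the unique point `w` of the outer conic for which the segment from `z` to `w` is tangent to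
the inner conic with positive orientation. This property determines `P`. -/
def IsPonceletMap (C₁ C : Matrix (Fin 3) (Fin 3) ℝ) (P : conic C₁ ≃ₜ conic C₁) : Prop :=
  ∀ z w : conic C₁, P z = w ↔ OrientedTangent 1 C z w

end PonceletPencil

open PonceletPencil

/-! Simultaneous diagonalisation turns the outer conic into the unit circle and the member with ν₂ =
1, ν₁ = t - λ₃ into t(x² + y² - 1) + a x² + b y² = 0, where a = λ₁ - λ₃ and b = λ₂ - λ₃ are positive
(`StandingAssumptions.exists_normalForm`). At the circle point of angle θ this form equals r(θ)² = a
cos² θ + b sin² θ, whatever t is. A chord touches the member when the Gram determinant of the form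
at its endpoints vanishes, and contact between the endpoints selects the root B = -r(θ) r(φ) for the
mixed value B. This equation is linear in t, so each chord touches exactly one member, with t =
`chordParam` ≥ 0; t = 0 is the limiting point.

The heart is `chordParam_flow`: along the flow θ' = r(θ), the parameter of the chord from θ(u) to
θ(u + c) does not depend on u. In the time coordinate u the outer conic is therefore a circle group,
and translation by c, for c between 0 and the time H of half a turn, is the Poncelet map of a single
member (`NormalForm.exists_uniformization`). A chord that takes longer than H is read backwards,
which gives the inverse map and the sign -1.

Hence each signed Poncelet map is the translation by the difference of the two endpoint coordinates
(`NormalForm.exists_ponceletMap`). These differences telescope, so the composition along a closed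
polygon is translation by 0. -/

namespace PonceletPencil

/-! ### Diagonal normal form of the pencil -/

/-- The symmetric bilinear form belonging to `quad C`. -/
def bil (C : Matrix (Fin 3) (Fin 3) ℝ) (u v : Fin 3 → ℝ) : ℝ := u ⬝ᵥ C.mulVec v

/-- Projective coordinates given by the matrix `M`, in which the two generators of the pencil are
diagonal, which preserve the orientation, and in which the closed interior of the first conic
lies in the affine chart. -/
structure NormalForm (C₁ C₂ M : Matrix (Fin 3) (Fin 3) ℝ) (lam₁ lam₂ lam₃ : ℝ) : Prop where
  lt₁₃ : lam₃ < lam₁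
  lt₂₃ : lam₃ < lam₂
  det_pos : 0 < M.det
  diag₁ : M.transpose * C₁ * M = Matrix.diagonal ![1, 1, -1]
  diag₂ : M.transpose * C₂ * M = Matrix.diagonal ![lam₁, lam₂, -lam₃]
  pos : 0 < M 2 2
  cone : M 2 0 ^ 2 + M 2 1 ^ 2 < M 2 2 ^ 2

lemma quad_smul (C : Matrix (Fin 3) (Fin 3) ℝ) (s : ℝ) (u : Fin 3 → ℝ) :
    quad C (s • u) = s ^ 2 * quad C u := by
  simp only [quad, Matrix.mulVec_smul, smul_dotProduct, dotProduct_smul, smul_eq_mul]; ring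

lemma bil_mulVec (C M : Matrix (Fin 3) (Fin 3) ℝ) (a b : Fin 3 → ℝ) :
    bil C (M.mulVec a) (M.mulVec b) = bil (M.transpose * C * M) a b := by
  simp only [bil]
  rw [← Matrix.mulVec_mulVec, ← Matrix.mulVec_mulVec, Matrix.dotProduct_mulVec a,
    Matrix.vecMul_transpose]

lemma bil_diagonal (d a b : Fin 3 → ℝ) :
    bil (Matrix.diagonal d) a b = d 0 * a 0 * b 0 + d 1 * a 1 * b 1 + d 2 * a 2 * b 2 := by
  simp only [bil, Matrix.mulVec_diagonal, dotProduct, Fin.sum_univ_three]; ring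

lemma OrderedSignature.quad_pos {C : Matrix (Fin 3) (Fin 3) ℝ} (h : OrderedSignature C)
    {u : Fin 3 → ℝ} (hu : u ≠ 0) (h2 : u 2 = 0) : 0 < quad C u := by
  have e : u = ![u 0, u 1, 0] := by
    ext i; fin_cases i <;> simp [h2]
  rw [e]
  apply h.pos
  intro h0
  apply hu
  rw [e]
  simp only [Prod.mk.injEq] at h0
  ext i; fin_cases i <;> simp [h0]

/-- Simultaneous diagonalisation of the two forms. -/
lemma StandingAssumptions.exists_diagonal {C₁ C₂ : Matrix (Fin 3) (Fin 3) ℝ} {lam₁ lam₂ lam₃ : ℝ}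
    (hC : StandingAssumptions C₁ C₂ lam₁ lam₂ lam₃) :
    ∃ (M : Matrix (Fin 3) (Fin 3) ℝ) (d : Fin 3 → ℝ), M.det ≠ 0 ∧
      M.transpose * C₁ * M = Matrix.diagonal d ∧
      M.transpose * C₂ * M = Matrix.diagonal ![lam₁ * d 0, lam₂ * d 1, lam₃ * d 2] := by
  obtain ⟨v₁, h₁⟩ := hC.eig₁.exists_hasEigenvector
  obtain ⟨v₂, h₂⟩ := hC.eig₂.exists_hasEigenvector
  obtain ⟨v₃, h₃⟩ := hC.eig₃.exists_hasEigenvector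
  have l12 := hC.lt₁₂
  have l23 := hC.lt₂₃
  set lam : Fin 3 → ℝ := ![lam₁, lam₂, lam₃] with hlam
  set v : Fin 3 → Fin 3 → ℝ := ![v₁, v₂, v₃] with hv
  have hinj : Function.Injective lam := by
    intro i j hij
    fin_cases i <;> fin_cases j <;> simp [lam] at hij ⊢ <;> linarith
  have hev : ∀ i, Module.End.HasEigenvector (Matrix.toLin' (C₁⁻¹ * C₂)) (lam i) (v i) := by
    intro i; fin_cases i <;> assumption
  have hli := Module.End.eigenvectors_linearIndependent' _ lam hinj v hev
  set M : Matrix (Fin 3) (Fin 3) ℝ := Matrix.of fun i j => v j i with hM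
  have hMu : IsUnit M := by
    rw [← Matrix.linearIndependent_cols_iff_isUnit]
    exact hli
  have hdet₁ : IsUnit C₁.det := hC.sig₁.det_neg.ne.isUnit
  have hcol : C₁⁻¹ * C₂ * M = M * Matrix.diagonal lam := by
    ext i j
    have := congrFun (hev j).apply_eq_smul i
    rw [Matrix.toLin'_apply] at this
    rw [Matrix.mul_diagonal, Matrix.mul_apply]
    simp only [Pi.smul_apply, smul_eq_mul] at this
    rw [hM, Matrix.of_apply, mul_comm, ← this]
    rfl
  have hC2M : C₂ * M = C₁ * M * Matrix.diagonal lam := by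
    rw [Matrix.mul_assoc C₁, ← hcol, Matrix.mul_assoc, Matrix.mul_nonsing_inv_cancel_left _ _ hdet₁]
  set S := M.transpose * C₁ * M with hS
  have hSsymm : S.transpose = S := by
    rw [hS, Matrix.transpose_mul, Matrix.transpose_mul, Matrix.transpose_transpose, hC.sig₁.symm.eq,
      Matrix.mul_assoc]
  have hS2 : M.transpose * C₂ * M = S * Matrix.diagonal lam := by
    rw [Matrix.mul_assoc, hC2M, hS]; simp only [Matrix.mul_assoc]
  have hS2symm : (S * Matrix.diagonal lam).transpose = S * Matrix.diagonal lam := by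
    rw [← hS2, Matrix.transpose_mul, Matrix.transpose_mul, Matrix.transpose_transpose,
      hC.sig₂.symm.eq, Matrix.mul_assoc]
  -- Both `S` and `S * diagonal lam` are symmetric, so (λᵢ - λⱼ) Sᵢⱼ = 0, and the eigenvalues are
  -- distinct.
  have hoff : ∀ i j, i ≠ j → S i j = 0 := by
    intro i j hij
    have e1 := congrFun (congrFun hS2symm i) j
    have e2 := congrFun (congrFun hSsymm i) j
    rw [Matrix.transpose_apply] at e2
    rw [Matrix.transpose_apply, Matrix.mul_diagonal, Matrix.mul_diagonal, e2] at e1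
    have : lam i - lam j ≠ 0 := sub_ne_zero.mpr fun h => hij (hinj h)
    have : S i j * (lam i - lam j) = 0 := by linear_combination e1
    exact (mul_eq_zero.mp this).resolve_right ‹_›
  have hSd : S = Matrix.diagonal fun i => S i i := by
    ext i j
    by_cases h : i = j
    · subst h; simp
    · rw [hoff i j h, Matrix.diagonal_apply_ne _ h]
  refine ⟨M, fun i => S i i, (M.isUnit_iff_isUnit_det.mp hMu).ne_zero, hSd, ?_⟩
  rw [hS2, hSd, Matrix.diagonal_mul_diagonal]
  congr 1
  ext i; fin_cases i <;> simp [lam, mul_comm]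

/-- The diagonalising basis is rescaled. The signs of the diagonal entries come from the inside
condition and the ordered signature; the free signs of the scaling factors are spent on orientation
and on the sign of the lower right entry. -/
lemma StandingAssumptions.exists_normalForm {C₁ C₂ : Matrix (Fin 3) (Fin 3) ℝ}
    {lam₁ lam₂ lam₃ : ℝ} (hC : StandingAssumptions C₁ C₂ lam₁ lam₂ lam₃) :
    ∃ M, NormalForm C₁ C₂ M lam₁ lam₂ lam₃ := by
  obtain ⟨M, d, hdet, hd₁, hd₂⟩ := hC.exists_diagonal
  have l12 := hC.lt₁₂
  have l23 := hC.lt₂₃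
  have l3 := hC.pos₃
  have hinj : ∀ a, M.mulVec a = 0 → a = 0 := fun a h => Matrix.eq_zero_of_mulVec_eq_zero hdet h
  have q₁ : ∀ a : Fin 3 → ℝ, quad C₁ (M.mulVec a) = d 0 * a 0 ^ 2 + d 1 * a 1 ^ 2 + d 2 * a 2 ^ 2 := by
    intro a
    have := bil_mulVec C₁ M a a
    rw [hd₁, bil_diagonal] at this
    simp only [quad]; rw [bil] at this; rw [this]; ring
  have q₂ : ∀ a : Fin 3 → ℝ, quad C₂ (M.mulVec a) =
      lam₁ * d 0 * a 0 ^ 2 + lam₂ * d 1 * a 1 ^ 2 + lam₃ * d 2 * a 2 ^ 2 := by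
    intro a
    have := bil_mulVec C₂ M a a
    rw [hd₂, bil_diagonal] at this
    simp only [quad]; rw [bil] at this; rw [this]; simp; ring
  have hprod : d 0 * d 1 * d 2 < 0 := by
    have := congrArg Matrix.det hd₁
    rw [Matrix.det_mul, Matrix.det_mul, Matrix.det_transpose, Matrix.det_diagonal,
      Fin.prod_univ_three] at this
    rw [← this]
    have := hC.sig₁.det_neg
    have h2 : 0 < M.det * M.det := mul_self_pos.mpr hdet
    nlinarith
  have in₁ : ∀ x z : ℝ, (x ≠ 0) → lam₁ * d 0 * x ^ 2 + lam₃ * d 2 * z ^ 2 = 0 →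
      d 0 * x ^ 2 + d 2 * z ^ 2 < 0 := by
    intro x z hx h
    have := hC.inside (M.mulVec ![x, 0, z]) (fun h0 => hx (by simpa using congrFun (hinj _ h0) 0))
      (by rw [q₂]; simpa using h)
    rw [q₁] at this; simpa using this
  have in₂ : ∀ x z : ℝ, (x ≠ 0) → lam₂ * d 1 * x ^ 2 + lam₃ * d 2 * z ^ 2 = 0 →
      d 1 * x ^ 2 + d 2 * z ^ 2 < 0 := by
    intro x z hx h
    have := hC.inside (M.mulVec ![0, x, z]) (fun h0 => hx (by simpa using congrFun (hinj _ h0) 1))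
      (by rw [q₂]; simpa using h)
    rw [q₁] at this; simpa using this
  -- A wrong sign pattern yields a zero of the second form at which the first form equals -e (l -
  -- λ₃)/λ₃ > 0, against the inside condition.
  have key : ∀ l e : ℝ, lam₃ < l → e < 0 → 0 < d 2 →
      ∃ z : ℝ, l * e * 1 ^ 2 + lam₃ * d 2 * z ^ 2 = 0 ∧ 0 < e * 1 ^ 2 + d 2 * z ^ 2 := by
    intro l e hl he hd
    have hn : 0 ≤ l * (-e) / (lam₃ * d 2) := by
      have : 0 < l := by linarith
      have : 0 < -e := neg_pos.mpr he
      exact (div_pos (mul_pos ‹_› ‹_›) (mul_pos l3 hd)).le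
    refine ⟨Real.sqrt (l * (-e) / (lam₃ * d 2)), ?_, ?_⟩
    · rw [Real.sq_sqrt hn]; field_simp; ring
    · rw [Real.sq_sqrt hn]
      have : e * 1 ^ 2 + d 2 * (l * -e / (lam₃ * d 2)) = (-e) * (l - lam₃) / lam₃ := by
        field_simp; ring
      rw [this]
      exact div_pos (mul_pos (by linarith) (by linarith)) l3
  have hd2 : d 2 < 0 := by
    by_contra hcon
    have hne : d 2 ≠ 0 := by rintro h; simp [h] at hprod
    have h2 : 0 < d 2 := lt_of_le_of_ne (not_lt.mp hcon) hne.symm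
    have h01 : d 0 * d 1 < 0 := by
      by_contra h; nlinarith [mul_nonneg (not_lt.mp h) h2.le]
    rcases mul_neg_iff.mp h01 with ⟨_, h⟩ | ⟨h, _⟩
    · obtain ⟨z, hz, hz'⟩ := key lam₂ (d 1) l23 h h2
      exact absurd (in₂ 1 z one_ne_zero hz) (not_lt.mpr hz'.le)
    · obtain ⟨z, hz, hz'⟩ := key lam₁ (d 0) (by linarith) h h2
      exact absurd (in₁ 1 z one_ne_zero hz) (not_lt.mpr hz'.le)
  have h01 : 0 < d 0 * d 1 := by
    by_contra h; nlinarith [mul_nonneg_of_nonpos_of_nonpos (not_lt.mp h) hd2.le]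
  have hsurj : ∀ u, M.mulVec (M⁻¹.mulVec u) = u := by
    intro u
    rw [Matrix.mulVec_mulVec, Matrix.mul_nonsing_inv _ hdet.isUnit, Matrix.one_mulVec]
  -- Otherwise the first form would be negative definite.
  have hd01 : 0 < d 0 ∧ 0 < d 1 := by
    rcases mul_pos_iff.mp h01 with h | ⟨h0, h1⟩
    · exact h
    · exfalso
      have hp := hC.sig₁.pos 1 0 (by simp)
      rw [← hsurj ![1, 0, 0], q₁] at hp
      nlinarith [sq_nonneg (M⁻¹.mulVec ![1, 0, 0] 0), sq_nonneg (M⁻¹.mulVec ![1, 0, 0] 1),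
        sq_nonneg (M⁻¹.mulVec ![1, 0, 0] 2)]
  have hM22 : M 2 2 ≠ 0 := by
    intro h
    have h3 : M.mulVec ![0, 0, 1] 2 = 0 := by
      simp [Matrix.mulVec, dotProduct, Fin.sum_univ_three, h]
    have hne : M.mulVec ![0, 0, 1] ≠ 0 := fun h0 => by simpa using congrFun (hinj _ h0) 2
    have := hC.sig₁.quad_pos hne h3
    rw [q₁] at this
    simp at this; linarith
  obtain ⟨s₂, hs₂, hs₂'⟩ : ∃ s : ℝ, s ^ 2 = (-d 2)⁻¹ ∧ 0 < M 2 2 * s := by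
    have : 0 < Real.sqrt (-d 2)⁻¹ := Real.sqrt_pos.mpr (inv_pos.mpr (by linarith))
    rcases lt_or_gt_of_ne hM22 with h | h
    · exact ⟨-Real.sqrt (-d 2)⁻¹, by rw [neg_sq, Real.sq_sqrt (inv_nonneg.mpr (by linarith))],
        by nlinarith⟩
    · exact ⟨Real.sqrt (-d 2)⁻¹, by rw [Real.sq_sqrt (inv_nonneg.mpr (by linarith))],
        mul_pos h this⟩
  obtain ⟨s₁, hs₁, hs₁'⟩ : ∃ s : ℝ, s ^ 2 = (d 1)⁻¹ ∧ 0 < s :=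
    ⟨Real.sqrt (d 1)⁻¹, Real.sq_sqrt (inv_nonneg.mpr hd01.2.le),
      Real.sqrt_pos.mpr (inv_pos.mpr hd01.2)⟩
  have hs₂0 : s₂ ≠ 0 := by rintro rfl; simp at hs₂'
  obtain ⟨s₀, hs₀, hs₀'⟩ : ∃ s : ℝ, s ^ 2 = (d 0)⁻¹ ∧ 0 < M.det * (s * s₁ * s₂) := by
    have hp : 0 < Real.sqrt (d 0)⁻¹ := Real.sqrt_pos.mpr (inv_pos.mpr hd01.1)
    have hsq : Real.sqrt (d 0)⁻¹ ^ 2 = (d 0)⁻¹ := Real.sq_sqrt (inv_nonneg.mpr hd01.1.le)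
    have hne : M.det * (Real.sqrt (d 0)⁻¹ * s₁ * s₂) ≠ 0 :=
      mul_ne_zero hdet (mul_ne_zero (mul_ne_zero hp.ne' hs₁'.ne') hs₂0)
    rcases lt_or_gt_of_ne hne with h | h
    · exact ⟨-Real.sqrt (d 0)⁻¹, by rw [neg_sq, hsq], by linarith⟩
    · exact ⟨Real.sqrt (d 0)⁻¹, hsq, h⟩
  set D := Matrix.diagonal ![s₀, s₁, s₂] with hD
  have conj : ∀ (C : Matrix (Fin 3) (Fin 3) ℝ) (e : Fin 3 → ℝ), M.transpose * C * M = Matrix.diagonal e →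
      (M * D).transpose * C * (M * D) =
        Matrix.diagonal ![s₀ ^ 2 * e 0, s₁ ^ 2 * e 1, s₂ ^ 2 * e 2] := by
    intro C e he
    have : (M * D).transpose * C * (M * D) = D * (M.transpose * C * M) * D := by
      rw [Matrix.transpose_mul, hD, Matrix.diagonal_transpose]; simp only [Matrix.mul_assoc]
    rw [this, he, hD, Matrix.diagonal_mul_diagonal, Matrix.diagonal_mul_diagonal]
    congr 1; ext i; fin_cases i <;> simp <;> ring
  have c0 : s₀ ^ 2 * d 0 = 1 := by rw [hs₀]; exact inv_mul_cancel₀ hd01.1.ne'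
  have c1 : s₁ ^ 2 * d 1 = 1 := by rw [hs₁]; exact inv_mul_cancel₀ hd01.2.ne'
  have c2 : s₂ ^ 2 * d 2 = -1 := by rw [hs₂, inv_neg, neg_mul, inv_mul_cancel₀ hd2.ne]
  have hdetN : 0 < (M * D).det := by
    rw [Matrix.det_mul, hD, Matrix.det_diagonal, Fin.prod_univ_three]; simpa using hs₀'
  have hN1 : (M * D).transpose * C₁ * (M * D) = Matrix.diagonal ![1, 1, -1] := by
    rw [conj C₁ d hd₁, c0, c1, c2]
  have hNpos : 0 < (M * D) 2 2 := by rw [hD, Matrix.mul_diagonal]; simpa using hs₂'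
  refine ⟨M * D, l23.trans l12, l23, hdetN, hN1, ?_, hNpos, ?_⟩
  · rw [conj C₂ _ hd₂]
    congr 1
    ext i; fin_cases i
    · simp; linear_combination lam₁ * c0
    · simp; linear_combination lam₂ * c1
    · simp; linear_combination lam₃ * c2
  · generalize M * D = N at *
    by_contra hcon
    -- A vector sent to the line at infinity, where the first form is positive. With r² = N₂₀² +
    -- N₂₁², its value at `a` is r²(N₂₂² - r²), which is not positive if the cone condition fails.
    set a : Fin 3 → ℝ := ![-N 2 0 * N 2 2, -N 2 1 * N 2 2, N 2 0 ^ 2 + N 2 1 ^ 2] with ha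
    have h2 : N.mulVec a 2 = 0 := by
      simp [Matrix.mulVec, dotProduct, Fin.sum_univ_three, ha]; ring
    have hne : N.mulVec a ≠ 0 := by
      intro h
      have := congrFun (Matrix.eq_zero_of_mulVec_eq_zero hdetN.ne' h) 2
      simp [ha] at this
      nlinarith
    have hq := hC.sig₁.quad_pos hne h2
    have e := bil_mulVec C₁ N a a
    rw [hN1, bil_diagonal] at e
    rw [quad] at hq; rw [bil] at e; rw [e] at hq
    simp [ha] at hq
    nlinarith [mul_nonneg (add_nonneg (sq_nonneg (N 2 0)) (sq_nonneg (N 2 1)))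
      (sub_nonneg.mpr (not_lt.mp hcon))]


/-! ### The flow on the circle and the invariant chord parameter -/

/-- The positive definite quadratic form `a x² + b y²` on the unit circle. -/
noncomputable def circleForm (a b θ : ℝ) : ℝ := a * Real.cos θ ^ 2 + b * Real.sin θ ^ 2

/-- The speed of the invariant flow on the circle. -/
noncomputable def speed (a b θ : ℝ) : ℝ := Real.sqrt (circleForm a b θ)

lemma circleForm_pos {a b : ℝ} (ha : 0 < a) (hb : 0 < b) (θ : ℝ) : 0 < circleForm a b θ := by
  unfold circleForm
  have h := Real.sin_sq_add_cos_sq θ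
  rcases eq_or_ne (Real.cos θ) 0 with h0 | h0
  · rw [h0] at h ⊢
    have : Real.sin θ ^ 2 = 1 := by linarith
    rw [this]; simpa
  · positivity

lemma speed_pos {a b : ℝ} (ha : 0 < a) (hb : 0 < b) (θ : ℝ) : 0 < speed a b θ :=
  Real.sqrt_pos.mpr (circleForm_pos ha hb θ)

lemma speed_sq {a b : ℝ} (ha : 0 < a) (hb : 0 < b) (θ : ℝ) :
    speed a b θ ^ 2 = a * Real.cos θ ^ 2 + b * Real.sin θ ^ 2 :=
  Real.sq_sqrt (circleForm_pos ha hb θ).le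

lemma continuous_speed (a b : ℝ) : Continuous (speed a b) := by
  unfold speed circleForm; fun_prop

lemma speed_add_pi (a b θ : ℝ) : speed a b (θ + Real.pi) = speed a b θ := by
  simp [speed, circleForm, Real.cos_add_pi, Real.sin_add_pi]

lemma hasDerivAt_speed {a b : ℝ} (ha : 0 < a) (hb : 0 < b) (θ : ℝ) :
    HasDerivAt (speed a b) ((b - a) * Real.sin θ * Real.cos θ / speed a b θ) θ := by
  have h1 : HasDerivAt (circleForm a b) (2 * ((b - a) * Real.sin θ * Real.cos θ)) θ := by
    have := (((Real.hasDerivAt_cos θ).pow 2).const_mul a).add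
      (((Real.hasDerivAt_sin θ).pow 2).const_mul b)
    refine this.congr_deriv ?_
    simp; ring
  have := h1.sqrt (circleForm_pos ha hb θ).ne'
  refine this.congr_deriv ?_
  rw [mul_div_mul_left _ _ two_ne_zero, speed]

/-- The flow of the vector field `speed` on the universal cover of the circle: a time
parametrisation `ϑ`, with half period `H`. -/
lemma exists_flow {a b : ℝ} (ha : 0 < a) (hb : 0 < b) :
    ∃ (ϑ : ℝ ≃o ℝ) (H : ℝ), 0 < H ∧ (∀ u, ϑ (u + H) = ϑ u + Real.pi) ∧
      ∀ u, HasDerivAt ϑ (speed a b (ϑ u)) u := by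
  set ρ : ℝ → ℝ := fun θ => (speed a b θ)⁻¹ with hρ
  have hρc : Continuous ρ := (continuous_speed a b).inv₀ fun θ => (speed_pos ha hb θ).ne'
  have hρpos : ∀ θ, 0 < ρ θ := fun θ => inv_pos.mpr (speed_pos ha hb θ)
  have hper : Function.Periodic ρ Real.pi := fun θ => by simp [hρ, speed_add_pi]
  -- The time needed to reach angle t; the flow is its inverse. Since `ρ` has period π, half a turn
  -- takes the same time from every starting angle.
  set F : ℝ → ℝ := fun t => ∫ x in (0 : ℝ)..t, ρ x with hF
  have hFd : ∀ t, HasDerivAt F (ρ t) t := fun t => (hρc.integral_hasStrictDerivAt 0 t).hasDerivAt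
  have hFm : StrictMono F := strictMono_of_deriv_pos fun t => by rw [(hFd t).deriv]; exact hρpos t
  have hFc : Continuous F := continuous_iff_continuousAt.mpr fun t => (hFd t).continuousAt
  have hi := hρc.intervalIntegrable (μ := MeasureTheory.volume) 0 Real.pi
  have hH : 0 < ∫ x in (0 : ℝ)..Real.pi, ρ x :=
    intervalIntegral.intervalIntegral_pos_of_pos hi hρpos Real.pi_pos
  have hs : Function.Surjective F := hFc.surjective
    (hper.tendsto_atTop_intervalIntegral_of_pos hH Real.pi_pos)
    (hper.tendsto_atBot_intervalIntegral_of_pos hH Real.pi_pos)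
  set e : ℝ ≃o ℝ := hFm.orderIsoOfSurjective F hs with he
  have heF : ∀ t, e t = F t := fun t => rfl
  have hadd : ∀ t, F (t + Real.pi) = F t + ∫ x in (0 : ℝ)..Real.pi, ρ x := by
    intro t
    have h1 := hper.intervalIntegral_add_eq t 0
    rw [zero_add] at h1
    rw [← h1, hF]
    exact (intervalIntegral.integral_add_adjacent_intervals (hρc.intervalIntegrable _ _)
      (hρc.intervalIntegrable _ _)).symm
  refine ⟨e.symm, ∫ x in (0 : ℝ)..Real.pi, ρ x, hH, ?_, ?_⟩
  · intro u
    rw [OrderIso.symm_apply_eq, heF, hadd, ← heF, OrderIso.apply_symm_apply]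
  · intro u
    have := HasDerivAt.of_local_left_inverse (f := e) (g := e.symm) (a := u)
      e.symm.continuous.continuousAt (hFd (e.symm u)) (hρpos _).ne'
      (Filter.Eventually.of_forall fun y => e.apply_symm_apply y)
    simpa [hρ] using this

/-- The parameter of the member of the pencil that touches the chord of the unit circle between
the angles `θ` and `φ`. -/
noncomputable def chordParam (a b θ φ : ℝ) : ℝ :=
  (speed a b θ * speed a b φ + a * Real.cos θ * Real.cos φ + b * Real.sin θ * Real.sin φ) /
    (1 - Real.cos (φ - θ))

/-- The parameter of the touching member is invariant under the flow. -/
lemma chordParam_flow {a b : ℝ} (ha : 0 < a) (hb : 0 < b) {ϑ : ℝ → ℝ}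
    (hϑ : ∀ u, HasDerivAt ϑ (speed a b (ϑ u)) u) (c : ℝ)
    (hc : ∀ u, Real.cos (ϑ (u + c) - ϑ u) ≠ 1) (u v : ℝ) :
    chordParam a b (ϑ u) (ϑ (u + c)) = chordParam a b (ϑ v) (ϑ (v + c)) := by
  have key : ∀ u, HasDerivAt (fun u => chordParam a b (ϑ u) (ϑ (u + c))) 0 u := by
    intro u
    have h1 := hϑ u
    have h2 : HasDerivAt (fun u => ϑ (u + c)) (speed a b (ϑ (u + c))) u :=
      (hϑ (u + c)).comp_add_const u c
    have r1 := (hasDerivAt_speed ha hb (ϑ u)).comp u h1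
    have r2 := (hasDerivAt_speed ha hb (ϑ (u + c))).comp u h2
    have d := (((r1.mul r2).add ((h1.cos.const_mul a).mul h2.cos)).add
      ((h1.sin.const_mul b).mul h2.sin)).div ((h2.sub h1).cos.const_sub 1)
      (sub_ne_zero.mpr (hc u).symm)
    refine HasDerivAt.congr_deriv (f := fun u => chordParam a b (ϑ u) (ϑ (u + c))) d ?_
    have p1 := speed_pos ha hb (ϑ u)
    have p2 := speed_pos ha hb (ϑ (u + c))
    have q1 := speed_sq ha hb (ϑ u)
    have q2 := speed_sq ha hb (ϑ (u + c))
    rw [div_eq_zero_iff]; left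
    simp only [Function.comp_apply, Pi.mul_apply, Pi.add_apply, Pi.sub_apply]
    -- Along the flow the speed has derivative (b - a) sin θ cos θ, without denominator, so the
    -- numerator of the quotient rule is a polynomial. It vanishes modulo the relations for the
    -- squared speeds and sin² + cos² = 1.
    rw [div_mul_cancel₀ _ p1.ne', div_mul_cancel₀ _ p2.ne', Real.cos_sub, Real.sin_sub]
    have t1 := Real.sin_sq_add_cos_sq (ϑ u)
    have t2 := Real.sin_sq_add_cos_sq (ϑ (u + c))
    generalize speed a b (ϑ u) = r at *
    generalize speed a b (ϑ (u + c)) = s at *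
    generalize Real.sin (ϑ u) = s1 at *
    generalize Real.cos (ϑ u) = c1 at *
    generalize Real.sin (ϑ (u + c)) = s2 at *
    generalize Real.cos (ϑ (u + c)) = c2 at *
    grind
  have hd : Differentiable ℝ (fun u => chordParam a b (ϑ u) (ϑ (u + c))) :=
    fun u => (key u).differentiableAt
  exact is_const_of_deriv_eq_zero hd (fun u => (key u).deriv) u v


/-! ### Tangency and orientation in homogeneous coordinates -/

section Bilinear
variable (C : Matrix (Fin 3) (Fin 3) ℝ)

lemma quad_eq_bil (u : Fin 3 → ℝ) : quad C u = bil C u u := rfl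

lemma bil_add_right (u v w : Fin 3 → ℝ) : bil C u (v + w) = bil C u v + bil C u w := by
  simp [bil, Matrix.mulVec_add, dotProduct_add]

lemma bil_sub_right (u v w : Fin 3 → ℝ) : bil C u (v - w) = bil C u v - bil C u w := by
  simp [bil, Matrix.mulVec_sub, dotProduct_sub]

lemma bil_smul_right (s : ℝ) (u v : Fin 3 → ℝ) : bil C u (s • v) = s * bil C u v := by
  simp [bil, Matrix.mulVec_smul, dotProduct_smul]

lemma bil_add_left (u v w : Fin 3 → ℝ) : bil C (u + v) w = bil C u w + bil C v w := by
  simp [bil, add_dotProduct]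

lemma bil_smul_left (s : ℝ) (u v : Fin 3 → ℝ) : bil C (s • u) v = s * bil C u v := by
  simp [bil, smul_dotProduct]

end Bilinear

lemma homog_injective : Function.Injective homog := by
  intro p q h
  have h0 := congrFun h 0
  have h1 := congrFun h 1
  simp [homog] at h0 h1
  exact Prod.ext h0 h1

lemma homog_two (p : ℝ × ℝ) : homog p 2 = 1 := by simp [homog]

lemma homog_sub (z w : ℝ × ℝ) : ![(w - z).1, (w - z).2, 0] = homog w - homog z := by
  ext i; fin_cases i <;> simp [homog]

/-- The weights need not be assumed to sum to 1: the last homogeneous coordinate forces it. -/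
lemma mem_segment_iff_homog {z w p : ℝ × ℝ} : p ∈ segment ℝ z w ↔
    ∃ x y : ℝ, 0 ≤ x ∧ 0 ≤ y ∧ homog p = x • homog z + y • homog w := by
  constructor
  · rintro ⟨x, y, hx, hy, hxy, rfl⟩
    refine ⟨x, y, hx, hy, ?_⟩
    ext i; fin_cases i <;> simp [homog, hxy]
  · rintro ⟨x, y, hx, hy, h⟩
    have h2 := congrFun h 2
    simp [homog] at h2
    refine ⟨x, y, hx, hy, h2.symm, ?_⟩
    have h0 := congrFun h 0
    have h1 := congrFun h 1
    simp [homog] at h0 h1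
    ext <;> simp [h0, h1]

/-- Tangency as conjugacy of the contact point to both endpoints. Its vanishing on the direction `w
- z` and at `p` itself, an affine combination of the endpoints, gives two independent linear
conditions. -/
lemma segTangent_iff {C : Matrix (Fin 3) (Fin 3) ℝ} {z w : ℝ × ℝ} : SegTangent C z w ↔
    z ≠ w ∧ ∃ p ∈ segment ℝ z w, bil C (homog p) (homog z) = 0 ∧
      bil C (homog p) (homog w) = 0 := by
  constructor
  · rintro ⟨hne, p, hp, hps, ht⟩
    refine ⟨hne, p, hps, ?_⟩
    obtain ⟨x, y, hx, hy, h⟩ := mem_segment_iff_homog.mp hps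
    have hxy := congrFun h 2
    simp [homog] at hxy
    have e : bil C (homog p) (homog w) - bil C (homog p) (homog z) = 0 := by
      rw [← bil_sub_right, ← homog_sub]; exact ht
    have q : bil C (homog p) (homog p) = 0 := hp
    rw [show bil C (homog p) (homog p) = bil C (homog p) (x • homog z + y • homog w) by rw [← h],
      bil_add_right, bil_smul_right, bil_smul_right] at q
    exact ⟨by linear_combination q - y * e + bil C (homog p) (homog z) * hxy,
      by linear_combination q + x * e + bil C (homog p) (homog w) * hxy⟩
  · rintro ⟨hne, p, hps, h1, h2⟩
    refine ⟨hne, p, ?_, hps, ?_⟩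
    · obtain ⟨x, y, hx, hy, h⟩ := mem_segment_iff_homog.mp hps
      change bil C (homog p) (homog p) = 0
      rw [show bil C (homog p) (homog p) = bil C (homog p) (x • homog z + y • homog w) by rw [← h],
        bil_add_right, bil_smul_right, bil_smul_right, h1, h2]; simp
    · rw [homog_sub]
      change bil C (homog p) _ = 0
      rw [bil_sub_right, h1, h2, sub_zero]

lemma segTangent_swap {C : Matrix (Fin 3) (Fin 3) ℝ} {z w : ℝ × ℝ} (h : SegTangent C z w) :
    SegTangent C w z := by
  rw [segTangent_iff] at h ⊢
  obtain ⟨hne, p, hp, h1, h2⟩ := h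
  exact ⟨hne.symm, p, by rwa [segment_symm], h2, h1⟩

lemma orientedTangent_neg_swap {C : Matrix (Fin 3) (Fin 3) ℝ} {z w : ℝ × ℝ}
    (h : OrientedTangent 1 C z w) : OrientedTangent (-1) C w z := by
  refine ⟨segTangent_swap h.1, fun q hq hqs => ?_⟩
  have := h.2 q hq (by rwa [segment_symm])
  simp [cross] at this ⊢
  linarith

/-- The determinant of three vectors. -/
def det₃ (u v w : Fin 3 → ℝ) : ℝ :=
  u 0 * (v 1 * w 2 - v 2 * w 1) - u 1 * (v 0 * w 2 - v 2 * w 0) + u 2 * (v 0 * w 1 - v 1 * w 0)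

lemma cross_eq_det₃ (z w q : ℝ × ℝ) :
    cross (w - z) (q - z) = det₃ (homog z) (homog w) (homog q) := by
  simp [cross, det₃, homog]; ring

lemma det₃_smul (r s t : ℝ) (u v w : Fin 3 → ℝ) :
    det₃ (r • u) (s • v) (t • w) = r * s * t * det₃ u v w := by
  simp [det₃]; ring

lemma det₃_mulVec (M : Matrix (Fin 3) (Fin 3) ℝ) (u v w : Fin 3 → ℝ) :
    det₃ (M.mulVec u) (M.mulVec v) (M.mulVec w) = M.det * det₃ u v w := by
  simp only [det₃, Matrix.det_fin_three, Matrix.mulVec, dotProduct, Fin.sum_univ_three]; ring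

/-- A line meets an ellipse in at most two points. -/
lemma OrderedSignature.eq_of_collinear {C : Matrix (Fin 3) (Fin 3) ℝ} (h : OrderedSignature C)
    {z w w' : ℝ × ℝ} (hz : z ∈ conic C) (hw : w ∈ conic C) (hw' : w' ∈ conic C) (hzw : z ≠ w)
    (hzw' : z ≠ w') {k : ℝ} (hk : w' - z = k • (w - z)) : w = w' := by
  set d : Fin 3 → ℝ := homog w - homog z with hd
  have hd' : homog w' - homog z = k • d := by
    rw [hd, ← homog_sub, ← homog_sub, hk]
    ext i; fin_cases i <;> simp
  have hq : 0 < quad C d := h.quad_pos (sub_ne_zero.mpr fun e => hzw (homog_injective e).symm)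
    (by simp [hd, homog])
  have e1 : homog w = homog z + (1 : ℝ) • d := by simp [hd]
  have e2 : homog w' = homog z + k • d := by rw [← hd']; simp
  have expand : ∀ k : ℝ, quad C (homog z + k • d) =
      quad C (homog z) + k * (bil C (homog z) d + bil C d (homog z)) + k ^ 2 * quad C d := by
    intro k
    simp only [quad_eq_bil, bil_add_left, bil_add_right, bil_smul_left, bil_smul_right]; ring
  have hz0 : quad C (homog z) = 0 := hz
  have f1 : quad C (homog w) = 0 := hw
  have f2 : quad C (homog w') = 0 := hw'
  rw [e1, expand, hz0] at f1
  rw [e2, expand, hz0] at f2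
  have hk0 : k ≠ 0 := by
    rintro rfl
    rw [zero_smul, sub_eq_zero] at hk
    exact hzw' hk.symm
  have : k * (k - 1) * quad C d = 0 := by linear_combination f2 - k * f1
  have hk1 : k = 1 := by
    rcases mul_eq_zero.mp this with h | h
    · rcases mul_eq_zero.mp h with h | h
      · exact absurd h hk0
      · linarith
    · exact absurd h hq.ne'
  rw [hk1, one_smul] at hk
  exact (sub_left_injective hk).symm

lemma exists_pos_of_mem_segment {z w p : ℝ × ℝ} (hp : p ∈ segment ℝ z w) (hne : p ≠ z) :
    ∃ s : ℝ, 0 < s ∧ p - z = s • (w - z) := by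
  rw [segment_eq_image'] at hp
  obtain ⟨s, hs, rfl⟩ := hp
  refine ⟨s, lt_of_le_of_ne hs.1 ?_, by simp⟩
  rintro rfl
  simp at hne

lemma cross_smul_right (s : ℝ) (v w : ℝ × ℝ) : cross v (s • w) = s * cross v w := by
  simp [cross]; ring

/-- From a point of an ellipse there is at most one positively oriented tangent segment to a conic
that does not contain this point. -/
lemma OrientedTangent.unique {C₁ C : Matrix (Fin 3) (Fin 3) ℝ} (h₁ : OrderedSignature C₁)
    {z w w' : ℝ × ℝ} (hz : z ∈ conic C₁) (hw : w ∈ conic C₁) (hw' : w' ∈ conic C₁)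
    (hzC : z ∉ conic C) (h : OrientedTangent 1 C z w) (h' : OrientedTangent 1 C z w') :
    w = w' := by
  obtain ⟨⟨hne, p, hp, hps, -⟩, ho⟩ := h
  obtain ⟨⟨hne', p', hp', hps', -⟩, ho'⟩ := h'
  obtain ⟨s, hs, e⟩ := exists_pos_of_mem_segment hps (by rintro rfl; exact hzC hp)
  obtain ⟨s', hs', e'⟩ := exists_pos_of_mem_segment hps' (by rintro rfl; exact hzC hp')
  have col : ∀ {r r' : ℝ} {v v' : ℝ × ℝ}, 0 < r' → r' • v' = r • v → v' = (r'⁻¹ * r) • v := by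
    intro r r' v v' hr' h
    rw [mul_smul, ← h, smul_smul, inv_mul_cancel₀ hr'.ne', one_smul]
  by_cases hc : p ∈ segment ℝ z w'
  · obtain ⟨t, ht, f⟩ := exists_pos_of_mem_segment hc (by rintro rfl; exact hzC hp)
    exact h₁.eq_of_collinear hz hw hw' hne hne' (col ht (f.symm.trans e))
  by_cases hc' : p' ∈ segment ℝ z w
  · obtain ⟨t, ht, f⟩ := exists_pos_of_mem_segment hc' (by rintro rfl; exact hzC hp')
    exact (h₁.eq_of_collinear hz hw' hw hne' hne (col ht (f.symm.trans e'))).symm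
  -- Each contact point now lies strictly to the left of the other segment, so each direction is to
  -- the left of the other, which antisymmetry of `cross` forbids.
  have i := ho' p hp hc
  have i' := ho p' hp' hc'
  rw [e, cross_smul_right] at i
  rw [e', cross_smul_right] at i'
  have j : 0 < cross (w' - z) (w - z) := by
    have : 0 < s * cross (w' - z) (w - z) := by simpa using i
    exact (mul_pos_iff_of_pos_left hs).mp this
  have j' : 0 < cross (w - z) (w' - z) := by
    have : 0 < s' * cross (w - z) (w' - z) := by simpa using i'
    exact (mul_pos_iff_of_pos_left hs').mp this
  simp only [cross] at j j'
  linarith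

/-! ### Angular parametrisation of the outer conic -/

/-- The point of the unit circle with angle `θ`, in homogeneous coordinates. -/
noncomputable def circleVec (θ : ℝ) : Fin 3 → ℝ := ![Real.cos θ, Real.sin θ, 1]

/-- The point of the outer conic with angle `θ` in the coordinates given by `M`. -/
noncomputable def arc (M : Matrix (Fin 3) (Fin 3) ℝ) (θ : ℝ) : ℝ × ℝ :=
  (M.mulVec (circleVec θ) 0 / M.mulVec (circleVec θ) 2,
    M.mulVec (circleVec θ) 1 / M.mulVec (circleVec θ) 2)

namespace NormalForm

variable {C₁ C₂ M : Matrix (Fin 3) (Fin 3) ℝ} {lam₁ lam₂ lam₃ : ℝ}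

lemma mulVec_two (M : Matrix (Fin 3) (Fin 3) ℝ) (a : Fin 3 → ℝ) :
    M.mulVec a 2 = M 2 0 * a 0 + M 2 1 * a 1 + M 2 2 * a 2 := by
  simp [Matrix.mulVec, dotProduct, Fin.sum_univ_three]

/-- By Cauchy–Schwarz and the cone condition, no point of the closed disc goes to infinity. -/
lemma mulVec_two_pos (h : NormalForm C₁ C₂ M lam₁ lam₂ lam₃) {a : Fin 3 → ℝ}
    (ha : a 0 ^ 2 + a 1 ^ 2 ≤ a 2 ^ 2) (h2 : 0 < a 2) : 0 < M.mulVec a 2 := by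
  rw [mulVec_two]
  have hp := mul_pos h.pos h2
  have h1 : (M 2 0 * a 0 + M 2 1 * a 1) ^ 2 < (M 2 2 * a 2) ^ 2 := by
    have c1 : (M 2 0 * a 0 + M 2 1 * a 1) ^ 2 ≤ (M 2 0 ^ 2 + M 2 1 ^ 2) * (a 0 ^ 2 + a 1 ^ 2) := by
      nlinarith [sq_nonneg (M 2 0 * a 1 - M 2 1 * a 0)]
    have c2 : (M 2 0 ^ 2 + M 2 1 ^ 2) * (a 0 ^ 2 + a 1 ^ 2) ≤ (M 2 0 ^ 2 + M 2 1 ^ 2) * a 2 ^ 2 :=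
      mul_le_mul_of_nonneg_left ha (by positivity)
    have c3 : (M 2 0 ^ 2 + M 2 1 ^ 2) * a 2 ^ 2 < M 2 2 ^ 2 * a 2 ^ 2 :=
      mul_lt_mul_of_pos_right h.cone (by positivity)
    rw [mul_pow]; linarith
  have := (abs_lt_of_sq_lt_sq' h1 hp.le).1
  linarith

lemma pos_of_mulVec_two_pos (h : NormalForm C₁ C₂ M lam₁ lam₂ lam₃) {a : Fin 3 → ℝ}
    (ha : a 0 ^ 2 + a 1 ^ 2 ≤ a 2 ^ 2) (h2 : 0 < M.mulVec a 2) : 0 < a 2 := by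
  rcases lt_trichotomy (a 2) 0 with h3 | h3 | h3
  · have := h.mulVec_two_pos (a := -a) (by simpa using ha) (by simpa using h3)
    rw [Matrix.mulVec_neg] at this
    simp at this; linarith
  · rw [mulVec_two, h3] at h2
    rw [h3] at ha
    have h0 : a 0 = 0 := by nlinarith [sq_nonneg (a 0), sq_nonneg (a 1)]
    have h1 : a 1 = 0 := by nlinarith [sq_nonneg (a 0), sq_nonneg (a 1)]
    simp [h0, h1] at h2
  · exact h3

lemma mulVec_injective (h : NormalForm C₁ C₂ M lam₁ lam₂ lam₃) :
    Function.Injective M.mulVec :=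
  Matrix.mulVec_injective_of_isUnit ((Matrix.isUnit_iff_isUnit_det M).mpr h.det_pos.ne'.isUnit)

lemma exists_mulVec_eq (h : NormalForm C₁ C₂ M lam₁ lam₂ lam₃) (u : Fin 3 → ℝ) :
    ∃ a, M.mulVec a = u :=
  ⟨M⁻¹.mulVec u, by
    rw [Matrix.mulVec_mulVec, Matrix.mul_nonsing_inv _ h.det_pos.ne'.isUnit, Matrix.one_mulVec]⟩

lemma bil_pencil (h : NormalForm C₁ C₂ M lam₁ lam₂ lam₃) (ν : ℝ × ℝ) (a b : Fin 3 → ℝ) :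
    bil (pencil C₁ C₂ ν) (M.mulVec a) (M.mulVec b) = (ν.1 + lam₁ * ν.2) * a 0 * b 0 +
      (ν.1 + lam₂ * ν.2) * a 1 * b 1 - (ν.1 + lam₃ * ν.2) * a 2 * b 2 := by
  have e : bil (pencil C₁ C₂ ν) (M.mulVec a) (M.mulVec b) =
      ν.1 * bil C₁ (M.mulVec a) (M.mulVec b) + ν.2 * bil C₂ (M.mulVec a) (M.mulVec b) := by
    simp only [bil, pencil, Matrix.add_mulVec, dotProduct_add, Matrix.smul_mulVec,
      dotProduct_smul, smul_eq_mul]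
  rw [e, bil_mulVec, bil_mulVec, h.diag₁, h.diag₂, bil_diagonal, bil_diagonal]
  simp; ring

lemma quad_outer (h : NormalForm C₁ C₂ M lam₁ lam₂ lam₃) (a : Fin 3 → ℝ) :
    quad C₁ (M.mulVec a) = a 0 ^ 2 + a 1 ^ 2 - a 2 ^ 2 := by
  rw [quad_eq_bil, bil_mulVec, h.diag₁, bil_diagonal]
  simp; ring

lemma circleVec_two_pos (h : NormalForm C₁ C₂ M lam₁ lam₂ lam₃) (θ : ℝ) :
    0 < M.mulVec (circleVec θ) 2 := by
  apply h.mulVec_two_pos <;> simp [circleVec]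

lemma homog_arc (h : NormalForm C₁ C₂ M lam₁ lam₂ lam₃) (θ : ℝ) :
    homog (arc M θ) = (M.mulVec (circleVec θ) 2)⁻¹ • M.mulVec (circleVec θ) := by
  have := (h.circleVec_two_pos θ).ne'
  ext i; fin_cases i <;> simp [homog, arc, div_eq_inv_mul, this]

lemma arc_mem (h : NormalForm C₁ C₂ M lam₁ lam₂ lam₃) (θ : ℝ) : arc M θ ∈ conic C₁ := by
  change quad C₁ _ = 0
  rw [h.homog_arc, quad_smul, h.quad_outer]
  simp [circleVec]

lemma continuous_arc (h : NormalForm C₁ C₂ M lam₁ lam₂ lam₃) : Continuous (arc M) := by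
  have hc : Continuous fun θ => M.mulVec (circleVec θ) := by
    refine continuous_const.matrix_mulVec (continuous_pi fun i => ?_)
    fin_cases i <;> simp [circleVec] <;> fun_prop
  have hi : ∀ i, Continuous fun θ => M.mulVec (circleVec θ) i := fun i => (continuous_apply i).comp hc
  exact ((hi 0).div (hi 2) fun θ => (h.circleVec_two_pos θ).ne').prodMk
    ((hi 1).div (hi 2) fun θ => (h.circleVec_two_pos θ).ne')

lemma arc_eq_arc (h : NormalForm C₁ C₂ M lam₁ lam₂ lam₃) {θ φ : ℝ} :
    arc M θ = arc M φ ↔ (θ : Real.Angle) = φ := by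
  constructor
  · intro e
    have e1 := congrArg homog e
    rw [h.homog_arc, h.homog_arc, ← Matrix.mulVec_smul, ← Matrix.mulVec_smul] at e1
    have e2 := h.mulVec_injective e1
    have k2 := congrFun e2 2
    simp only [Pi.smul_apply, smul_eq_mul, show ∀ t, circleVec t 2 = 1 from fun t => rfl,
      mul_one] at k2
    rw [k2] at e2
    have e3 := smul_right_injective (Fin 3 → ℝ)
      (inv_ne_zero (h.circleVec_two_pos φ).ne') e2
    exact Real.Angle.cos_sin_inj (by simpa [circleVec] using congrFun e3 0)
      (by simpa [circleVec] using congrFun e3 1)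
  · intro e
    have : circleVec θ = circleVec φ := by
      unfold circleVec
      rw [← Real.Angle.cos_coe, ← Real.Angle.sin_coe, e, Real.Angle.cos_coe, Real.Angle.sin_coe]
    simp [arc, this]

lemma exists_arc_eq (h : NormalForm C₁ C₂ M lam₁ lam₂ lam₃) {p : ℝ × ℝ} (hp : p ∈ conic C₁) :
    ∃ θ, arc M θ = p := by
  obtain ⟨a, ha⟩ := h.exists_mulVec_eq (homog p)
  have hq : quad C₁ (homog p) = 0 := hp
  rw [← ha, h.quad_outer] at hq
  have h2 : 0 < a 2 := h.pos_of_mulVec_two_pos (by linarith) (by rw [ha, homog_two]; exact one_pos)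
  have hcirc : (a 0 / a 2) ^ 2 + (a 1 / a 2) ^ 2 = 1 := by
    field_simp; linarith
  set c : ℂ := ⟨a 0 / a 2, a 1 / a 2⟩ with hc
  have hn : ‖c‖ = 1 := by
    rw [Complex.norm_def, Complex.normSq_apply, Real.sqrt_eq_one]
    simp only [hc]; linarith
  have hc0 : c ≠ 0 := by rintro h0; rw [h0] at hn; simp at hn
  refine ⟨c.arg, homog_injective ?_⟩
  have hv : a = a 2 • circleVec c.arg := by
    have e0 : Real.cos c.arg = a 0 / a 2 := by rw [Complex.cos_arg hc0, hn, div_one]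
    have e1 : Real.sin c.arg = a 1 / a 2 := by rw [Complex.sin_arg, hn, div_one]
    ext i; fin_cases i <;> simp [circleVec, e0, e1] <;> field_simp
  have k := homog_two p
  rw [← ha, hv, Matrix.mulVec_smul] at k
  simp only [Pi.smul_apply, smul_eq_mul] at k
  rw [h.homog_arc, ← ha, hv, Matrix.mulVec_smul, ← eq_inv_of_mul_eq_one_left k]

end NormalForm


/-! ### Chords and the pencil members they touch -/

lemma cos_ne_one_of_pos_of_lt {x : ℝ} (h0 : 0 < x) (h1 : x < 2 * Real.pi) : Real.cos x ≠ 1 := by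
  intro h
  rw [Real.cos_eq_one_iff_of_lt_of_lt (by linarith) h1] at h
  exact h0.ne' h

/-- Cauchy–Schwarz for the form a x² + b y² at the two circle points. -/
lemma chordParam_nonneg {a b : ℝ} (ha : 0 < a) (hb : 0 < b) (θ φ : ℝ) :
    0 ≤ chordParam a b θ φ := by
  refine div_nonneg ?_ (sub_nonneg.mpr (Real.cos_le_one _))
  have p := mul_pos (speed_pos ha hb θ) (speed_pos ha hb φ)
  have hsq : (a * Real.cos θ * Real.cos φ + b * Real.sin θ * Real.sin φ) ^ 2 ≤
      (speed a b θ * speed a b φ) ^ 2 := by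
    rw [mul_pow, speed_sq ha hb, speed_sq ha hb]
    nlinarith [mul_nonneg (mul_pos ha hb).le
      (sq_nonneg (Real.cos θ * Real.sin φ - Real.sin θ * Real.cos φ))]
  linarith [(abs_le_of_sq_le_sq' hsq p.le).1]

lemma chordParam_antipodal {a b : ℝ} (ha : 0 < a) (hb : 0 < b) (θ : ℝ) :
    chordParam a b θ (θ + Real.pi) = 0 := by
  rw [chordParam, speed_add_pi, Real.cos_add_pi, Real.sin_add_pi, div_eq_zero_iff]
  left
  linear_combination speed_sq ha hb θ

lemma homog_combination (z w : ℝ × ℝ) {x y : ℝ} (hxy : x + y = 1) :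
    homog (x • z + y • w) = x • homog z + y • homog w := by
  ext i; fin_cases i <;> simp [homog, hxy]

namespace NormalForm

variable {C₁ C₂ M : Matrix (Fin 3) (Fin 3) ℝ} {lam₁ lam₂ lam₃ : ℝ}

lemma bil_circleVec (h : NormalForm C₁ C₂ M lam₁ lam₂ lam₃) (ν : ℝ × ℝ) (θ φ : ℝ) :
    bil (pencil C₁ C₂ ν) (M.mulVec (circleVec θ)) (M.mulVec (circleVec φ)) =
      (ν.1 + lam₃ * ν.2) * (Real.cos (φ - θ) - 1) + ν.2 * ((lam₁ - lam₃) * Real.cos θ * Real.cos φ +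
        (lam₂ - lam₃) * Real.sin θ * Real.sin φ) := by
  rw [h.bil_pencil, Real.cos_sub]
  simp [circleVec]; ring

/-- The first form vanishes on the circle, so only ν₂ survives: all members induce the same speed up
to scale. -/
lemma quad_circleVec (h : NormalForm C₁ C₂ M lam₁ lam₂ lam₃) (ν : ℝ × ℝ) (θ : ℝ) :
    bil (pencil C₁ C₂ ν) (M.mulVec (circleVec θ)) (M.mulVec (circleVec θ)) =
      ν.2 * speed (lam₁ - lam₃) (lam₂ - lam₃) θ ^ 2 := by
  rw [h.bil_circleVec, speed_sq (sub_pos.mpr h.lt₁₃) (sub_pos.mpr h.lt₂₃), sub_self, Real.cos_zero]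
  ring

lemma bil_circleVec_comm (h : NormalForm C₁ C₂ M lam₁ lam₂ lam₃) (ν : ℝ × ℝ) (θ φ : ℝ) :
    bil (pencil C₁ C₂ ν) (M.mulVec (circleVec θ)) (M.mulVec (circleVec φ)) =
      bil (pencil C₁ C₂ ν) (M.mulVec (circleVec φ)) (M.mulVec (circleVec θ)) := by
  rw [h.bil_pencil, h.bil_pencil]; ring

lemma arc_notMem (h : NormalForm C₁ C₂ M lam₁ lam₂ lam₃) {ν : ℝ × ℝ} (hν : 0 < ν.2) (θ : ℝ) :
    arc M θ ∉ conic (pencil C₁ C₂ ν) := by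
  intro hm
  have h0 : quad (pencil C₁ C₂ ν) (homog (arc M θ)) = 0 := hm
  rw [h.homog_arc, quad_smul, quad_eq_bil, h.quad_circleVec] at h0
  have := h.circleVec_two_pos θ
  have := speed_pos (sub_pos.mpr h.lt₁₃) (sub_pos.mpr h.lt₂₃) θ
  exact absurd h0 (by positivity)

lemma cos_ne_one_of_arc_ne (h : NormalForm C₁ C₂ M lam₁ lam₂ lam₃) {θ φ : ℝ}
    (hne : arc M θ ≠ arc M φ) : Real.cos (φ - θ) ≠ 1 := by
  intro hc
  apply hne
  rw [h.arc_eq_arc]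
  obtain ⟨n, hn⟩ := (Real.cos_eq_one_iff _).mp hc
  rw [eq_comm, Real.Angle.angle_eq_iff_two_pi_dvd_sub]
  exact ⟨n, by linarith⟩

/-- A chord of the outer conic determines the member of the pencil that it touches. -/
lemma eq_chordParam_of_segTangent (h : NormalForm C₁ C₂ M lam₁ lam₂ lam₃) {μ : ℝ × ℝ}
    (hμ : 0 < μ.2) {θ φ : ℝ} (ht : SegTangent (pencil C₁ C₂ μ) (arc M θ) (arc M φ)) :
    μ.1 + lam₃ * μ.2 = μ.2 * chordParam (lam₁ - lam₃) (lam₂ - lam₃) θ φ := by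
  obtain ⟨hne, p, hps, h1, h2⟩ := segTangent_iff.mp ht
  have hcos : 1 - Real.cos (φ - θ) ≠ 0 := sub_ne_zero.mpr (h.cos_ne_one_of_arc_ne hne).symm
  obtain ⟨x, y, hx, hy, hp⟩ := mem_segment_iff_homog.mp hps
  have hxy := congrFun hp 2
  simp only [Pi.add_apply, Pi.smul_apply, homog_two, smul_eq_mul, mul_one] at hxy
  have k1 := h.circleVec_two_pos θ
  have k2 := h.circleVec_two_pos φ
  have r1 := speed_pos (sub_pos.mpr h.lt₁₃) (sub_pos.mpr h.lt₂₃) θ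
  have r2 := speed_pos (sub_pos.mpr h.lt₁₃) (sub_pos.mpr h.lt₂₃) φ
  rw [hp, h.homog_arc θ, h.homog_arc φ] at h1 h2
  simp only [bil_add_left, bil_smul_left, bil_smul_right, h.quad_circleVec,
    h.bil_circleVec_comm μ φ θ] at h1 h2
  have hB := h.bil_circleVec μ θ φ
  set B := bil (pencil C₁ C₂ μ) (M.mulVec (circleVec θ)) (M.mulVec (circleVec φ)) with hBdef
  set i1 := (M.mulVec (circleVec θ) 2)⁻¹ with hi1
  set i2 := (M.mulVec (circleVec φ) 2)⁻¹ with hi2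
  have p1 : 0 < i1 := inv_pos.mpr k1
  have p2 : 0 < i2 := inv_pos.mpr k2
  unfold chordParam
  set r := speed (lam₁ - lam₃) (lam₂ - lam₃) θ
  set s := speed (lam₁ - lam₃) (lam₂ - lam₃) φ
  -- The weights of the contact point with respect to the unnormalised circle vectors.
  set X := x * i1 with hX
  set Y := y * i2 with hY
  have e1 : X * (μ.2 * r ^ 2) + Y * B = 0 := by
    have : i1 * (X * (μ.2 * r ^ 2) + Y * B) = 0 := by linear_combination h1
    exact (mul_eq_zero.mp this).resolve_left p1.ne'
  have e2 : X * B + Y * (μ.2 * s ^ 2) = 0 := by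
    have : i2 * (X * B + Y * (μ.2 * s ^ 2)) = 0 := by linear_combination h2
    exact (mul_eq_zero.mp this).resolve_left p2.ne'
  have hX0 : 0 ≤ X := mul_nonneg hx p1.le
  have hYpos : 0 < Y := by
    refine lt_of_le_of_ne (mul_nonneg hy p2.le) fun hY0 => ?_
    rw [← hY0, zero_mul, add_zero] at e1
    have hX00 : X = 0 := (mul_eq_zero.mp e1).resolve_right (by positivity)
    have x0 : x = 0 := (mul_eq_zero.mp hX00).resolve_right p1.ne'
    have y0 : y = 0 := (mul_eq_zero.mp hY0.symm).resolve_right p2.ne'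
    rw [x0, y0] at hxy; norm_num at hxy
  -- Nonnegative weights, that is contact within the segment, decide the sign of the root of the
  -- Gram equation below.
  have hBneg : B ≤ 0 := by
    by_contra hcon
    have := mul_pos hYpos (not_le.mp hcon)
    have : 0 ≤ X * (μ.2 * r ^ 2) := by positivity
    linarith
  have hBsq : (-B) ^ 2 = (μ.2 * r * s) ^ 2 := by
    have : Y * (B ^ 2 - (μ.2 * r * s) ^ 2) = 0 := by
      linear_combination B * e1 - μ.2 * r ^ 2 * e2
    have := (mul_eq_zero.mp this).resolve_left hYpos.ne'
    linarith
  have hBval : -B = μ.2 * r * s := (sq_eq_sq₀ (by linarith) (by positivity)).mp hBsq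
  rw [mul_div_assoc', eq_div_iff hcos]
  linear_combination hB + hBval

lemma bil_eq_neg_of_chordParam (h : NormalForm C₁ C₂ M lam₁ lam₂ lam₃) {θ φ : ℝ}
    (hcos : Real.cos (φ - θ) ≠ 1) :
    bil (pencil C₁ C₂ (chordParam (lam₁ - lam₃) (lam₂ - lam₃) θ φ - lam₃, 1))
      (M.mulVec (circleVec θ)) (M.mulVec (circleVec φ)) =
      -(speed (lam₁ - lam₃) (lam₂ - lam₃) θ * speed (lam₁ - lam₃) (lam₂ - lam₃) φ) := by
  rw [h.bil_circleVec]
  have : 1 - Real.cos (φ - θ) ≠ 0 := sub_ne_zero.mpr hcos.symm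
  unfold chordParam
  field_simp
  ring

/-- Every chord of the outer conic touches the member of the pencil with its parameter. -/
lemma segTangent_chordParam (h : NormalForm C₁ C₂ M lam₁ lam₂ lam₃) {θ φ : ℝ}
    (hne : arc M θ ≠ arc M φ) :
    SegTangent (pencil C₁ C₂ (chordParam (lam₁ - lam₃) (lam₂ - lam₃) θ φ - lam₃, 1))
      (arc M θ) (arc M φ) := by
  have hB := h.bil_eq_neg_of_chordParam (h.cos_ne_one_of_arc_ne hne)
  have k1 := h.circleVec_two_pos θ
  have k2 := h.circleVec_two_pos φ
  have r1 := speed_pos (sub_pos.mpr h.lt₁₃) (sub_pos.mpr h.lt₂₃) θ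
  have r2 := speed_pos (sub_pos.mpr h.lt₁₃) (sub_pos.mpr h.lt₂₃) φ
  have hA := h.homog_arc θ
  have hA' := h.homog_arc φ
  set ν : ℝ × ℝ := (chordParam (lam₁ - lam₃) (lam₂ - lam₃) θ φ - lam₃, 1) with hν
  have hν2 : ν.2 = 1 := rfl
  have q1 := h.quad_circleVec ν θ
  have q2 := h.quad_circleVec ν φ
  have hcomm := h.bil_circleVec_comm ν φ θ
  set r := speed (lam₁ - lam₃) (lam₂ - lam₃) θ
  set s := speed (lam₁ - lam₃) (lam₂ - lam₃) φ
  set k := M.mulVec (circleVec θ) 2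
  set l := M.mulVec (circleVec φ) 2
  have hS : 0 < k * s + l * r := by positivity
  have hsum : k * s / (k * s + l * r) + l * r / (k * s + l * r) = 1 := by
    rw [← add_div, div_self hS.ne']
  -- With mixed value -r s and squares r², s², the combination of the circle vectors with weights s
  -- and r is conjugate to both. The factors k and l convert these into affine weights.
  refine segTangent_iff.mpr ⟨hne, (k * s / (k * s + l * r)) • arc M θ +
    (l * r / (k * s + l * r)) • arc M φ, ⟨_, _, by positivity, by positivity, hsum, rfl⟩, ?_, ?_⟩
  · rw [homog_combination _ _ hsum, hA, hA']
    simp only [bil_add_left, bil_smul_left, bil_smul_right, q1, hcomm, hB, hν2]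
    field_simp; ring
  · rw [homog_combination _ _ hsum, hA, hA']
    simp only [bil_add_left, bil_smul_left, bil_smul_right, q2, hB, hν2]
    field_simp; ring

/-- A point of the limiting member of the pencil is the third coordinate point. -/
lemma exists_homog_eq_of_mem_limit (h : NormalForm C₁ C₂ M lam₁ lam₂ lam₃) {p : ℝ × ℝ}
    (hp : p ∈ conic (pencil C₁ C₂ (limitParam lam₃))) :
    ∃ c : ℝ, homog p = c • M.mulVec ![0, 0, 1] := by
  obtain ⟨a, ha⟩ := h.exists_mulVec_eq (homog p)
  have h0 : quad (pencil C₁ C₂ (limitParam lam₃)) (homog p) = 0 := hp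
  rw [← ha, quad_eq_bil, h.bil_pencil] at h0
  simp only [limitParam] at h0
  have l1 := sub_pos.mpr h.lt₁₃
  have l2 := sub_pos.mpr h.lt₂₃
  have s1 := mul_nonneg l1.le (sq_nonneg (a 0))
  have s2 := mul_nonneg l2.le (sq_nonneg (a 1))
  have h0' : (lam₁ - lam₃) * a 0 ^ 2 + (lam₂ - lam₃) * a 1 ^ 2 = 0 := by linear_combination h0
  have a0 : a 0 = 0 := by
    have : (lam₁ - lam₃) * a 0 ^ 2 = 0 := by linarith
    simpa using (mul_eq_zero.mp this).resolve_left l1.ne'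
  have a1 : a 1 = 0 := by
    have : (lam₂ - lam₃) * a 1 ^ 2 = 0 := by linarith
    simpa using (mul_eq_zero.mp this).resolve_left l2.ne'
  refine ⟨a 2, ?_⟩
  rw [← ha, ← Matrix.mulVec_smul]
  congr 1
  ext i; fin_cases i <;> simp [a0, a1]

/-- The limiting member of the pencil has at most one point. -/
lemma conic_limit_subsingleton (h : NormalForm C₁ C₂ M lam₁ lam₂ lam₃) {p q : ℝ × ℝ}
    (hp : p ∈ conic (pencil C₁ C₂ (limitParam lam₃)))
    (hq : q ∈ conic (pencil C₁ C₂ (limitParam lam₃))) : p = q := by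
  obtain ⟨c, hc⟩ := h.exists_homog_eq_of_mem_limit hp
  obtain ⟨d, hd⟩ := h.exists_homog_eq_of_mem_limit hq
  have e1 := congrFun hc 2
  have e2 := congrFun hd 2
  simp only [homog_two, Pi.smul_apply, smul_eq_mul] at e1 e2
  apply homog_injective
  rw [hc, hd, eq_div_of_mul_eq (right_ne_zero_of_mul (e1 ▸ one_ne_zero)) e1.symm,
    eq_div_of_mul_eq (right_ne_zero_of_mul (e1 ▸ one_ne_zero)) e2.symm]

/-- A segment through the limiting point is tangent to the limiting member of the pencil. -/
lemma segTangent_limit (h : NormalForm C₁ C₂ M lam₁ lam₂ lam₃) {z w p : ℝ × ℝ} (hne : z ≠ w)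
    (hp : p ∈ conic (pencil C₁ C₂ (limitParam lam₃))) (hps : p ∈ segment ℝ z w) :
    SegTangent (pencil C₁ C₂ (limitParam lam₃)) z w := by
  obtain ⟨c, hc⟩ := h.exists_homog_eq_of_mem_limit hp
  have key : ∀ u, bil (pencil C₁ C₂ (limitParam lam₃)) (homog p) u = 0 := by
    intro u
    obtain ⟨a, rfl⟩ := h.exists_mulVec_eq u
    rw [hc, bil_smul_left, h.bil_pencil]
    simp [limitParam]
  exact segTangent_iff.mpr ⟨hne, p, hps, key _, key _⟩

/-- A chord of the outer conic of length at most half a turn is positively oriented. -/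
lemma orientedTangent_chordParam (h : NormalForm C₁ C₂ M lam₁ lam₂ lam₃) {θ φ : ℝ}
    (h0 : θ < φ) (h1 : φ ≤ θ + Real.pi) :
    OrientedTangent 1 (pencil C₁ C₂ (chordParam (lam₁ - lam₃) (lam₂ - lam₃) θ φ - lam₃, 1))
      (arc M θ) (arc M φ) := by
  have hpi := Real.pi_pos
  have hcos : Real.cos (φ - θ) ≠ 1 := cos_ne_one_of_pos_of_lt (by linarith) (by linarith)
  have l1 := sub_pos.mpr h.lt₁₃
  have l2 := sub_pos.mpr h.lt₂₃
  have hne : arc M θ ≠ arc M φ := by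
    intro e
    rw [h.arc_eq_arc, eq_comm] at e
    apply hcos
    rw [← Real.Angle.cos_coe, Real.Angle.coe_sub, e, sub_self, Real.Angle.cos_zero]
  have hT := h.segTangent_chordParam hne
  refine ⟨hT, fun q hq hqs => ?_⟩
  have hB := h.bil_eq_neg_of_chordParam hcos
  -- For t = 0 the conic is the contact point alone, so no point is left to orient.
  rcases (chordParam_nonneg l1 l2 θ φ).eq_or_lt with ht | ht
  · exfalso
    rw [← ht, zero_sub] at hT hq
    obtain ⟨-, p, hp, hps, -⟩ := hT
    rw [h.conic_limit_subsingleton hp hq] at hps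
    exact hqs hps
  have hlt : φ - θ < Real.pi := by
    refine lt_of_le_of_ne (by linarith) fun e => ?_
    rw [show φ = θ + Real.pi by linarith, chordParam_antipodal l1 l2] at ht
    exact ht.false
  have hsin : 0 < Real.sin (φ - θ) := Real.sin_pos_of_pos_of_lt_pi (by linarith) hlt
  obtain ⟨v, hv⟩ := h.exists_mulVec_eq (homog q)
  have hQ : quad (pencil C₁ C₂ (chordParam (lam₁ - lam₃) (lam₂ - lam₃) θ φ - lam₃, 1))
    (homog q) = 0 := hq
  rw [← hv, quad_eq_bil, h.bil_pencil] at hQ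
  rw [h.bil_circleVec] at hB
  have r1 := speed_pos l1 l2 θ
  have r2 := speed_pos l1 l2 φ
  have s1 := speed_sq l1 l2 θ
  have s2 := speed_sq l1 l2 φ
  have k1 := h.circleVec_two_pos θ
  have k2 := h.circleVec_two_pos φ
  have hA := h.homog_arc θ
  have hA' := h.homog_arc φ
  set t := chordParam (lam₁ - lam₃) (lam₂ - lam₃) θ φ
  have v2 : 0 < v 2 := by
    refine h.pos_of_mulVec_two_pos ?_ (by rw [hv, homog_two]; exact one_pos)
    have : t * (v 0 ^ 2 + v 1 ^ 2) ≤ t * v 2 ^ 2 := by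
      have := mul_nonneg l1.le (sq_nonneg (v 0))
      have := mul_nonneg l2.le (sq_nonneg (v 1))
      simp only at hQ
      nlinarith
    exact le_of_mul_le_mul_left this ht
  -- By Cramer's rule, v is expanded in the two circle vectors and (0, 0, 1). The last coefficient
  -- `w` vanishes on the chord and its sign tells the side.
  obtain ⟨x, hx⟩ : ∃ x, x = (v 0 * Real.sin φ - v 1 * Real.cos φ) / Real.sin (φ - θ) := ⟨_, rfl⟩
  obtain ⟨y, hy⟩ : ∃ y, y = (v 1 * Real.cos θ - v 0 * Real.sin θ) / Real.sin (φ - θ) := ⟨_, rfl⟩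
  obtain ⟨w, hw⟩ : ∃ w, w = v 2 - x - y := ⟨_, rfl⟩
  rw [eq_div_iff hsin.ne'] at hx hy
  have hss := Real.sin_sub φ θ
  have hcs := Real.cos_sub φ θ
  have e0 : v 0 = x * Real.cos θ + y * Real.cos φ :=
    mul_right_cancel₀ hsin.ne' (by rw [add_mul]; linear_combination v 0 * hss - Real.cos θ * hx - Real.cos φ * hy)
  have e1 : v 1 = x * Real.sin θ + y * Real.sin φ :=
    mul_right_cancel₀ hsin.ne' (by rw [add_mul]; linear_combination v 1 * hss - Real.sin θ * hx - Real.sin φ * hy)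
  have e2 : v 2 = x + y + w := by rw [hw]; ring
  have t1 := Real.sin_sq_add_cos_sq θ
  have t2 := Real.sin_sq_add_cos_sq φ
  -- In these coordinates tangency makes the conic a perfect square against t w (2 v₂ - w). As t and
  -- v₂ are positive, w < 0 is impossible, and w = 0 leaves only the contact point.
  have hid : (speed (lam₁ - lam₃) (lam₂ - lam₃) θ * x - speed (lam₁ - lam₃) (lam₂ - lam₃) φ * y) ^ 2 =
      t * w * (2 * v 2 - w) := by
    simp only at hQ hB
    rw [hcs] at hB
    rw [e0, e1, e2] at hQ
    rw [e2]
    generalize speed (lam₁ - lam₃) (lam₂ - lam₃) θ = r at *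
    generalize speed (lam₁ - lam₃) (lam₂ - lam₃) φ = s at *
    linear_combination hQ + x ^ 2 * s1 + y ^ 2 * s2 - 2 * x * y * hB - t * x ^ 2 * t1 - t * y ^ 2 * t2
  have hw0 : 0 < w := by
    rcases lt_trichotomy w 0 with hw0 | hw0 | hw0
    · have : t * w * (2 * v 2 - w) < 0 :=
        mul_neg_of_neg_of_pos (mul_neg_of_pos_of_neg ht hw0) (by linarith)
      rw [← hid] at this
      exact absurd this (not_lt.mpr (sq_nonneg _))
    · exfalso
      apply hqs
      rw [hw0, mul_zero, zero_mul] at hid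
      rw [hw0, add_zero] at e2
      have hxy := pow_eq_zero_iff two_ne_zero |>.mp hid
      have hx0 : 0 < x := by
        by_contra hc
        have : 0 < y := by linarith
        have := mul_pos r2 this
        have := mul_nonneg r1.le (neg_nonneg.mpr (not_lt.mp hc))
        linarith
      have hy0 : 0 < y := by
        by_contra hc
        have := mul_pos r1 hx0
        have := mul_nonneg r2.le (neg_nonneg.mpr (not_lt.mp hc))
        linarith
      refine mem_segment_iff_homog.mpr ⟨x * M.mulVec (circleVec θ) 2, y * M.mulVec (circleVec φ) 2,
        by positivity, by positivity, ?_⟩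
      rw [hA, hA', smul_smul, smul_smul, mul_assoc, mul_assoc, mul_inv_cancel₀ k1.ne',
        mul_inv_cancel₀ k2.ne', mul_one, mul_one, ← hv, ← Matrix.mulVec_smul, ← Matrix.mulVec_smul,
        ← Matrix.mulVec_add]
      congr 1
      ext i; fin_cases i <;> simp [circleVec, e0, e1, e2]
    · exact hw0
  have hdet : det₃ (circleVec θ) (circleVec φ) v = w * Real.sin (φ - θ) := by
    simp only [det₃, circleVec, e0, e1, e2, hss]
    simp; ring
  rw [cross_eq_det₃, hA, hA', ← hv, ← one_smul ℝ (M.mulVec v), det₃_smul, det₃_mulVec, hdet]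
  have := h.det_pos
  simp only [Units.val_one, Int.cast_one]
  positivity

end NormalForm


/-! ### Translations of the circle group and Poncelet maps -/

section Translate

variable {A X : Type*} [AddCommGroup A] [TopologicalSpace A] [ContinuousAdd A] [TopologicalSpace X]

/-- The translation by `x`, transported along a homeomorphism. -/
def conjTranslation (Φ : A ≃ₜ X) (x : A) : X ≃ₜ X := Φ.symm.trans ((Homeomorph.addRight x).trans Φ)

lemma conjTranslation_apply (Φ : A ≃ₜ X) (x : A) (p : X) : conjTranslation Φ x p = Φ (Φ.symm p + x) := rfl

lemma conjTranslation_mul (Φ : A ≃ₜ X) (x y : A) :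
    conjTranslation Φ x * conjTranslation Φ y = conjTranslation Φ (x + y) := by
  ext p
  change conjTranslation Φ x (conjTranslation Φ y p) = _
  simp only [conjTranslation_apply, Homeomorph.symm_apply_apply]
  congr 1; abel

lemma conjTranslation_zero (Φ : A ≃ₜ X) : conjTranslation Φ (0 : A) = 1 := by
  ext p
  change _ = p
  simp [conjTranslation_apply]

lemma conjTranslation_inv (Φ : A ≃ₜ X) (x : A) : (conjTranslation Φ x)⁻¹ = conjTranslation Φ (-x) := by
  rw [inv_eq_iff_mul_eq_one, conjTranslation_mul, add_neg_cancel, conjTranslation_zero]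

/-- The increments telescope. The list is reversed because a product of homeomorphisms applies its
rightmost factor first. -/
lemma prod_reverse_conjTranslation (Φ : A ≃ₜ X) (N : ℕ) (y : Fin (N + 1) → A) :
    (List.ofFn fun k : Fin N => conjTranslation Φ (y k.succ - y k.castSucc)).reverse.prod =
      conjTranslation Φ (y (Fin.last N) - y 0) := by
  induction N with
  | zero => simp [conjTranslation_zero]
  | succ n ih =>
    rw [List.ofFn_succ, List.reverse_cons, List.prod_append, List.prod_singleton]
    have := ih fun i => y i.succ
    simp only [Fin.succ_castSucc] at this ⊢
    rw [this, conjTranslation_mul]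
    congr 1
    simp

end Translate

/-- The outer conic is a circle group on which each translation by at most half a turn is a
positively oriented Poncelet correspondence. -/
lemma NormalForm.exists_uniformization {C₁ C₂ M : Matrix (Fin 3) (Fin 3) ℝ}
    {lam₁ lam₂ lam₃ : ℝ} (h : NormalForm C₁ C₂ M lam₁ lam₂ lam₃) :
    ∃ H : ℝ, 0 < H ∧ ∃ Φ : AddCircle (2 * H) ≃ₜ conic C₁, ∀ c : ℝ, 0 < c → c ≤ H →
      ∃ t : ℝ, 0 ≤ t ∧ ∀ x, OrientedTangent 1 (pencil C₁ C₂ (t - lam₃, 1)) (Φ x)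
        (Φ (x + (c : AddCircle (2 * H)))) := by
  have l1 := sub_pos.mpr h.lt₁₃
  have l2 := sub_pos.mpr h.lt₂₃
  obtain ⟨ϑ, H, hH, hadd, hd⟩ := exists_flow l1 l2
  have hadd2 : ∀ u, ϑ (u + 2 * H) = ϑ u + 2 * Real.pi := fun u => by
    rw [two_mul, ← add_assoc, hadd, hadd]; ring
  have hper : Function.Periodic (fun u => ϑ u - u * (Real.pi / H)) (2 * H) := by
    intro u
    change ϑ (u + 2 * H) - (u + 2 * H) * (Real.pi / H) = ϑ u - u * (Real.pi / H)
    rw [hadd2]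
    field_simp; ring
  have haddn : ∀ (n : ℤ) (u : ℝ), ϑ (u + n * (2 * H)) = ϑ u + 2 * Real.pi * n := by
    intro n u
    have := hper.int_mul n u
    have e : n * (2 * H) * (Real.pi / H) = 2 * Real.pi * n := by field_simp
    linear_combination this + e
  set G : ℝ → conic C₁ := fun u => ⟨arc M (ϑ u), h.arc_mem _⟩ with hG
  have hGeq : ∀ u v, G u = G v ↔ (u : AddCircle (2 * H)) = v := by
    intro u v
    rw [hG, Subtype.mk.injEq, h.arc_eq_arc, Real.Angle.angle_eq_iff_two_pi_dvd_sub,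
      QuotientAddGroup.eq_iff_sub_mem, AddSubgroup.mem_zmultiples_iff]
    refine exists_congr fun n => ?_
    rw [zsmul_eq_mul, eq_comm (b := u - v), sub_eq_iff_eq_add', sub_eq_iff_eq_add', ← haddn,
      ϑ.injective.eq_iff]
  have hGp : Function.Periodic G (2 * H) := fun u => (hGeq _ _).mpr (by simp)
  have : Fact (0 < 2 * H) := ⟨by positivity⟩
  have hbij : Function.Bijective (hGp.lift : AddCircle (2 * H) → conic C₁) := by
    constructor
    · intro x y
      induction x using QuotientAddGroup.induction_on
      induction y using QuotientAddGroup.induction_on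
      intro e
      exact (hGeq _ _).mp e
    · intro p
      obtain ⟨θ, hθ⟩ := h.exists_arc_eq p.2
      exact ⟨(ϑ.symm θ : ℝ), Subtype.ext (by simpa [hG] using hθ)⟩
  have hcont : Continuous (hGp.lift : AddCircle (2 * H) → conic C₁) :=
    continuous_quot_lift _ ((h.continuous_arc.comp ϑ.continuous).subtype_mk _)
  let Φ : AddCircle (2 * H) ≃ₜ conic C₁ :=
    Continuous.homeoOfEquivCompactToT2 (f := Equiv.ofBijective _ hbij) hcont
  refine ⟨H, hH, Φ, fun c hc0 hcH => ⟨chordParam (lam₁ - lam₃) (lam₂ - lam₃) (ϑ 0) (ϑ (0 + c)),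
    chordParam_nonneg l1 l2 _ _, fun x => ?_⟩⟩
  induction x using QuotientAddGroup.induction_on with | H u => ?_
  have lt : ∀ u, ϑ u < ϑ (u + c) := fun u => ϑ.strictMono (by linarith)
  have le : ∀ u, ϑ (u + c) ≤ ϑ u + Real.pi := fun u => by
    rw [← hadd]; exact ϑ.monotone (by linarith)
  -- Flow invariance replaces the parameter at time 0 by that at time u, so one member serves all
  -- starting points.
  rw [chordParam_flow l1 l2 hd c (fun u => cos_ne_one_of_pos_of_lt (sub_pos.mpr (lt u))
    (by linarith [le u, Real.pi_pos])) 0 u]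
  exact h.orientedTangent_chordParam (lt u) (le u)

/-- The statement of the theorem for a single segment: its signed Poncelet map is a translation. -/
lemma NormalForm.exists_ponceletMap {C₁ C₂ M : Matrix (Fin 3) (Fin 3) ℝ}
    {lam₁ lam₂ lam₃ : ℝ} (h : NormalForm C₁ C₂ M lam₁ lam₂ lam₃) (h₁ : OrderedSignature C₁) {H : ℝ}
    (hH : 0 < H) (Φ : AddCircle (2 * H) ≃ₜ conic C₁)
    (hΦ : ∀ c : ℝ, 0 < c → c ≤ H → ∃ t : ℝ, 0 ≤ t ∧ ∀ x, OrientedTangent 1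
      (pencil C₁ C₂ (t - lam₃, 1)) (Φ x) (Φ (x + (c : AddCircle (2 * H)))))
    {z w : conic C₁} (hne : z ≠ w) :
    ∃ (ν : ℝ × ℝ) (σ : ℤˣ) (P : conic C₁ ≃ₜ conic C₁),
      ((Disjoint (segment ℝ (z : ℝ × ℝ) w) (conic (pencil C₁ C₂ (limitParam lam₃))) →
          IsValid lam₃ ν) ∧
        (¬ Disjoint (segment ℝ (z : ℝ × ℝ) w) (conic (pencil C₁ C₂ (limitParam lam₃))) →
          ν = limitParam lam₃)) ∧
      IsPonceletMap C₁ (pencil C₁ C₂ ν) P ∧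
      (OrientedTangent σ (pencil C₁ C₂ ν) z w ∧
        ∀ μ : ℝ × ℝ, (IsValid lam₃ μ ∨ μ = limitParam lam₃) →
          SegTangent (pencil C₁ C₂ μ) z w → conic (pencil C₁ C₂ μ) = conic (pencil C₁ C₂ ν)) ∧
      P ^ ((σ : ℤˣ) : ℤ) = conjTranslation Φ (Φ.symm w - Φ.symm z) := by
  have hmap : ∀ (t c : ℝ), (∀ x, OrientedTangent 1
      (pencil C₁ C₂ (t - lam₃, 1)) (Φ x) (Φ (x + (c : AddCircle (2 * H))))) →
      IsPonceletMap C₁ (pencil C₁ C₂ (t - lam₃, 1)) (conjTranslation Φ (c : AddCircle (2 * H))) := by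
    intro t c ht z w
    have hz := ht (Φ.symm z)
    rw [← conjTranslation_apply, Homeomorph.apply_symm_apply] at hz
    constructor
    · rintro rfl; exact hz
    · intro hw
      refine Subtype.ext (hz.unique h₁ z.2 (Subtype.prop _) w.2 ?_ hw)
      obtain ⟨θ, hθ⟩ := h.exists_arc_eq z.2
      rw [← hθ]
      exact h.arc_notMem one_pos θ
  obtain ⟨t, σ, P, ht, hP, hO, hPσ⟩ : ∃ (t : ℝ) (σ : ℤˣ) (P : conic C₁ ≃ₜ conic C₁), 0 ≤ t ∧
      IsPonceletMap C₁ (pencil C₁ C₂ (t - lam₃, 1)) P ∧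
      OrientedTangent σ (pencil C₁ C₂ (t - lam₃, 1)) z w ∧
      P ^ ((σ : ℤˣ) : ℤ) = conjTranslation Φ (Φ.symm w - Φ.symm z) := by
    have : Fact (0 < 2 * H) := ⟨by positivity⟩
    obtain ⟨c, hc, hcd⟩ : ∃ c ∈ Set.Ico (0 : ℝ) (0 + 2 * H),
        (c : AddCircle (2 * H)) = Φ.symm w - Φ.symm z :=
      ⟨_, (AddCircle.equivIco (2 * H) 0 (Φ.symm w - Φ.symm z)).2,
        (AddCircle.equivIco (2 * H) 0).symm_apply_apply _⟩
    have hc0 : 0 < c := by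
      refine lt_of_le_of_ne hc.1 ?_
      rintro rfl
      rw [AddCircle.coe_zero, eq_comm, sub_eq_zero] at hcd
      exact hne (Φ.symm.injective hcd).symm
    have hc2 := hc.2
    rw [zero_add] at hc2
    -- If the segment takes more than half a turn, its reverse takes time 2H - c ≤ H and is
    -- positively oriented; hence the sign -1 and the inverse translation.
    rcases le_total c H with hcH | hcH
    · obtain ⟨t, ht, hT⟩ := hΦ c hc0 hcH
      refine ⟨t, 1, conjTranslation Φ c, ht, hmap t c hT, ?_, by simp [hcd]⟩
      have := hT (Φ.symm z)
      rwa [hcd, add_sub_cancel, Homeomorph.apply_symm_apply, Homeomorph.apply_symm_apply] at this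
    · obtain ⟨t, ht, hT⟩ := hΦ (2 * H - c) (by linarith) (by linarith)
      have hcd' : ((2 * H - c : ℝ) : AddCircle (2 * H)) = Φ.symm z - Φ.symm w := by
        rw [AddCircle.coe_sub, AddCircle.coe_period, hcd]; abel
      refine ⟨t, -1, conjTranslation Φ (2 * H - c : ℝ), ht, hmap t _ hT, ?_, ?_⟩
      · have := hT (Φ.symm w)
        rw [hcd', add_sub_cancel, Homeomorph.apply_symm_apply, Homeomorph.apply_symm_apply] at this
        exact orientedTangent_neg_swap this
      · rw [hcd']; simp [conjTranslation_inv]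
  obtain ⟨θ, hθ⟩ := h.exists_arc_eq z.2
  obtain ⟨φ, hφ⟩ := h.exists_arc_eq w.2
  have uniq : ∀ μ : ℝ × ℝ, 0 < μ.2 → SegTangent (pencil C₁ C₂ μ) z w →
      μ.1 + lam₃ * μ.2 = μ.2 * t := by
    intro μ hμ hs
    have hT := hO.1
    rw [← hθ, ← hφ] at hs hT
    have e := h.eq_chordParam_of_segTangent (μ := (t - lam₃, 1)) one_pos hT
    simp only at e
    linear_combination h.eq_chordParam_of_segTangent hμ hs - μ.2 * e
  refine ⟨(t - lam₃, 1), σ, P, ⟨fun hdis => ⟨one_pos, ?_⟩, fun hdis => ?_⟩, hP, ⟨hO, ?_⟩, hPσ⟩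
  · have : 0 < t := by
      refine lt_of_le_of_ne ht ?_
      rintro rfl
      obtain ⟨-, p, hp, hps, -⟩ := hO.1
      rw [zero_sub] at hp
      exact Set.disjoint_left.mp hdis hps hp
    simpa
  · obtain ⟨p, hps, hp⟩ := Set.not_disjoint_iff.mp hdis
    have := uniq _ one_pos (h.segTangent_limit (fun e => hne (Subtype.ext e)) hp hps)
    simp only [limitParam] at this ⊢
    have t0 : t = 0 := by linarith
    rw [t0, zero_sub]
  · intro μ hμ hs
    have hμ2 : 0 < μ.2 := by
      rcases hμ with hv | rfl
      · exact hv.1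
      · exact one_pos
    have e := uniq μ hμ2 hs
    -- The chord fixes the parameter only up to a positive factor, so uniqueness is that of the
    -- conic, not of `μ`.
    have hpen : pencil C₁ C₂ μ = μ.2 • pencil C₁ C₂ (t - lam₃, 1) := by
      rw [pencil, pencil, smul_add, smul_smul, smul_smul, mul_one,
        show μ.1 = μ.2 * (t - lam₃) by linear_combination e]
    ext p
    simp only [conic, Set.mem_ofPred_eq, hpen, quad, Matrix.smul_mulVec, dotProduct_smul,
      smul_eq_mul, mul_eq_zero, hμ2.ne', false_or]

end PonceletPencil

theorem mainTheorem6 (C₁ C₂ : Matrix (Fin 3) (Fin 3) ℝ) (lam₁ lam₂ lam₃ : ℝ)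
    (hC : StandingAssumptions C₁ C₂ lam₁ lam₂ lam₃)
    (N : ℕ) (z : Fin (N + 1) → conic C₁)
    (hz : ∀ k : Fin N, z k.castSucc ≠ z k.succ) :
    ∃ (ν : Fin N → ℝ × ℝ) (σ : Fin N → ℤˣ) (P : Fin N → (conic C₁ ≃ₜ conic C₁)),
      -- the parameters are valid, up to the limiting member of the pencil
      (∀ k : Fin N,
        (Disjoint (segment ℝ (z k.castSucc : ℝ × ℝ) (z k.succ))
            (conic (pencil C₁ C₂ (limitParam lam₃))) → IsValid lam₃ (ν k)) ∧
        (¬ Disjoint (segment ℝ (z k.castSucc : ℝ × ℝ) (z k.succ))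
            (conic (pencil C₁ C₂ (limitParam lam₃))) → ν k = limitParam lam₃)) ∧
      -- `P k` is the Poncelet map with caustic given by the parameter `ν k`
      (∀ k : Fin N, IsPonceletMap C₁ (pencil C₁ C₂ (ν k)) (P k)) ∧
      -- tangency with orientation, and uniqueness of the ellipse
      (∀ k : Fin N,
        OrientedTangent (σ k) (pencil C₁ C₂ (ν k)) (z k.castSucc) (z k.succ) ∧
        ∀ μ : ℝ × ℝ, (IsValid lam₃ μ ∨ μ = limitParam lam₃) →
          SegTangent (pencil C₁ C₂ μ) (z k.castSucc) (z k.succ) →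
            conic (pencil C₁ C₂ μ) = conic (pencil C₁ C₂ (ν k))) ∧
      -- the maps carry each point to the next one
      (∀ k : Fin N, (P k ^ ((σ k : ℤˣ) : ℤ)) (z k.castSucc) = z k.succ) ∧
      -- closing up: the composition, first map applied first, is the identity
      (z 0 = z (Fin.last N) →
        (List.ofFn fun k : Fin N => P k ^ ((σ k : ℤˣ) : ℤ)).reverse.prod = 1) := by
  obtain ⟨M, hM⟩ := hC.exists_normalForm
  obtain ⟨H, hH, Φ, hΦ⟩ := hM.exists_uniformization
  choose ν σ P hν hP hT hPσ using fun k => hM.exists_ponceletMap hC.sig₁ hH Φ hΦ (hz k)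
  refine ⟨ν, σ, P, hν, hP, hT, fun k => ?_, fun hclosed => ?_⟩
  · rw [hPσ, conjTranslation_apply, add_sub_cancel, Homeomorph.apply_symm_apply]
  · simp only [hPσ]
    rw [prod_reverse_conjTranslation Φ N fun i => Φ.symm (z i), hclosed, sub_self, conjTranslation_zero]
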